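/- \emph{Pure types} are the closed expressions of the grammar $\tau ::= \mathbf 1 \mid \tau\times\tau \mid \tau\to\tau \mid \tau+\tau \mid X \mid \mathrm{rec}\,X.\tau$, where $\mathrm{rec}\,X$ binds the type variable $X$. A \emph{cpo} is a poset with a least element and suprema of all (nonempty) directed subsets; an element $d$ of a cpo is \emph{finite} if, for every directed $D$ with $d\le\bigvee D$, there is $x\in D$ with $d\le x$; and $\uparrow d=\{x\mid d\le x\}$. A type expression with $n$ free type variables is interpreted as a functor of $n$ arguments on the category of cpos and embedding-projection pairs: $[\![\mathbf 1]\!]=\{\bot\le\top\}$; $[\![\sigma\times\tau]\!]$ is the product with the component-wise order; $[\![\sigma\to\tau]\!]$ is the set of Scott-continuous functions with the pointwise order; $[\![\sigma+\tau]\!]$ is the disjoint union with a new least element; and $[\![\mathrm{rec}\,X.\tau]\!]$ is the colimit of the $\omega$-chain $\{\bot\}\to G(\{\bot\})\to G^2(\{\bot\})\to\cdots$ obtained by iterating $G=[\![\tau]\!]$ in its argument $X$, with the canonical isomorphism $\mathrm{unfold}:[\![\mathrm{rec}\,X.\tau]\!]\to[\![\tau[\mathrm{rec}\,X.\tau/X]]\!]$.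 So each pure type $\tau$ is interpreted as a cpo $[\![\tau]\!]$ (in fact a Scott domain). For pure types $\tau$, the sets $\mathcal L^\wedge(\tau)$ of formulae are inductively generated as follows: $\top,\bot\in\mathcal L^\wedge(\tau)$; if $\varphi,\psi\in\mathcal L^\wedge(\tau)$ then $\varphi\wedge\psi\in\mathcal L^\wedge(\tau)$; $\langle\rangle\in\mathcal L^\wedge(\mathbf 1)$; if $\varphi\in\mathcal L^\wedge(\tau_i)$ then $\langle\pi_i\rangle\varphi\in\mathcal L^\wedge(\tau_1\times\tau_2)$ and $\langle\mathrm{in}_i\rangle\varphi\in\mathcal L^\wedge(\tau_1+\tau_2)$ $(i=1,2)$; if $\varphi\in\mathcal L^\wedge(\tau[\mathrm{rec}\,X.\tau/X])$ then $\langle\mathrm{fold}\rangle\varphi\in\mathcal L^\wedge(\mathrm{rec}\,X.\tau)$; if $\psi\in\mathcal L^\wedge(\sigma)$ and $\varphi\in\mathcal L^\wedge(\tau)$ then $\psi\Vdash\varphi\in\mathcal L^\wedge(\sigma\to\tau)$. Each $\varphi\in\mathcal L^\wedge(\tau)$ defines a set $[\![\varphi]\!]\subseteq[\![\tau]\!]$: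 $[\![\top]\!]=[\![\tau]\!]$, $[\![\bot]\!]=\emptyset$, $[\![\varphi\wedge\psi]\!]=[\![\varphi]\!]\cap[\![\psi]\!]$, $[\![\langle\rangle]\!]=\{\top\}$, $[\![\langle\pi_i\rangle\varphi]\!]=\{x\mid\pi_i(x)\in[\![\varphi]\!]\}$, $[\![\langle\mathrm{in}_i\rangle\varphi]\!]=\{\mathrm{in}_i(x)\mid x\in[\![\varphi]\!]\}$, $[\![\langle\mathrm{fold}\rangle\varphi]\!]=\{x\mid\mathrm{unfold}(x)\in[\![\varphi]\!]\}$, and $[\![\psi\Vdash\varphi]\!]=\{f\mid\forall x\in[\![\psi]\!],\ f(x)\in[\![\varphi]\!]\}$. \textbf{Proposition.} Let $\tau$ be a pure type. (1) For every $\delta\in\mathcal L^\wedge(\tau)$ with $[\![\delta]\!]\neq\emptyset$ there is a finite $d\in[\![\tau]\!]$ with $[\![\delta]\!]=\uparrow d$. (2) Conversely, for every finite $d\in[\![\tau]\!]$ there is $\delta\in\mathcal L^\wedge(\tau)$ with $\uparrow d=[\![\delta]\!]$. -/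

import Mathlib

open CategoryTheory

attribute [-instance] CategoryTheory.catToReflQuiver

namespace DomainLogic

/-! ## Complete partial orders and Scott-continuous functions -/

/-- A bundled cpo: a partial order with a least element and with suprema of all directed subsets. -/
structure Cpo : Type 1 where
  carrier : Type
  [cpo : CompletePartialOrder carrier]

instance : CoeSort Cpo Type := ⟨Cpo.carrier⟩

instance (X : Cpo) : CompletePartialOrder X := X.cpo

/-- A partial order with a least element and suprema of nonempty directed sets is a cpo. -/
noncomputable abbrev cpoOfExists (α : Type) [PartialOrder α] (b : α) (hb : ∀ x, b ≤ x)
    (h : ∀ D : Set α, D.Nonempty → DirectedOn (· ≤ ·) D → ∃ s, IsLUB D s) :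
    CompletePartialOrder α :=
  letI : SupSet α := ⟨fun D => @Classical.epsilon α ⟨b⟩ (fun s => IsLUB D s)⟩
  { (inferInstance : PartialOrder α) with
    bot := b
    bot_le := hb
    lubOfDirected := fun D hD => by
      have hex : ∃ s, IsLUB D s := by
        rcases D.eq_empty_or_nonempty with rfl | hne
        · exact ⟨b, by simp, fun x _ => hb x⟩
        · exact h D hne hD
      exact Classical.epsilon_spec hex }

/-- Scott-continuous functions, i.e. those that preserve directed suprema. -/
structure ScottMap (X Y : Type) [Preorder X] [Preorder Y] where
  toFun : X → Y
  cont : ScottContinuous toFun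

namespace ScottMap

variable {X Y Z : Type}

instance [Preorder X] [Preorder Y] : FunLike (ScottMap X Y) X Y where
  coe := toFun
  coe_injective := by rintro ⟨f, _⟩ ⟨g, _⟩ h; cases h; rfl

@[ext] theorem ext [Preorder X] [Preorder Y] {f g : ScottMap X Y} (h : ∀ x, f x = g x) : f = g :=
  DFunLike.ext _ _ h

theorem mono [Preorder X] [Preorder Y] (f : ScottMap X Y) : Monotone f := f.cont.monotone

@[simp] theorem mk_apply [Preorder X] [Preorder Y] (f : X → Y) (h) (x : X) :
    (ScottMap.mk f h) x = f x := rfl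

/-- The pointwise order. -/
instance [Preorder X] [PartialOrder Y] : PartialOrder (ScottMap X Y) where
  le f g := ∀ x, f x ≤ g x
  le_refl _ _ := le_rfl
  le_trans _ _ _ h h' x := (h x).trans (h' x)
  le_antisymm _ _ h h' := ext fun x => le_antisymm (h x) (h' x)

theorem le_def [Preorder X] [PartialOrder Y] {f g : ScottMap X Y} :
    f ≤ g ↔ ∀ x, f x ≤ g x := Iff.rfl

theorem le_apply [Preorder X] [PartialOrder Y] {f g : ScottMap X Y} (h : f ≤ g) (x : X) :
    f x ≤ g x := h x

/-- The identity. -/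
def id (X : Type) [Preorder X] : ScottMap X X := ⟨fun x => x, ScottContinuous.id⟩

/-- Composition, `(g.comp f) x = g (f x)`. -/
def comp [Preorder X] [Preorder Y] [Preorder Z] (g : ScottMap Y Z) (f : ScottMap X Y) :
    ScottMap X Z := ⟨fun x => g (f x), ScottContinuous.comp (f := f) (g := g) f.cont g.cont⟩

@[simp] theorem id_apply [Preorder X] (x : X) : id X x = x := rfl

@[simp] theorem comp_apply [Preorder X] [Preorder Y] [Preorder Z] (g : ScottMap Y Z)
    (f : ScottMap X Y) (x : X) : g.comp f x = g (f x) := rfl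

theorem directed_image [Preorder X] [Preorder Y] {f : X → Y} (hf : Monotone f) {D : Set X}
    (hD : DirectedOn (· ≤ ·) D) : DirectedOn (· ≤ ·) (f '' D) := by
  rintro _ ⟨x, hx, rfl⟩ _ ⟨y, hy, rfl⟩
  obtain ⟨z, hz, h1, h2⟩ := hD x hx y hy
  exact ⟨_, ⟨z, hz, rfl⟩, hf h1, hf h2⟩

theorem scott_of [Preorder X] [Preorder Y] {f : X → Y} (hf : Monotone f)
    (h : ∀ (D : Set X) (s : X), D.Nonempty → DirectedOn (· ≤ ·) D → IsLUB D s →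
      ∀ u, (∀ x ∈ D, f x ≤ u) → f s ≤ u) : ScottContinuous f := by
  intro D hne hD s hs
  refine ⟨?_, fun u hu => h D s hne hD hs u fun x hx => hu ⟨x, hx, rfl⟩⟩
  rintro _ ⟨x, hx, rfl⟩
  exact hf (hs.1 hx)

theorem map_le [Preorder X] [Preorder Y] (f : ScottMap X Y) {D : Set X} {s : X}
    (hne : D.Nonempty) (hD : DirectedOn (· ≤ ·) D) (hs : IsLUB D s) {u : Y}
    (hu : ∀ x ∈ D, f x ≤ u) : f s ≤ u :=
  (f.cont hne hD hs).2 (by rintro _ ⟨x, hx, rfl⟩; exact hu x hx)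

/-- The pointwise supremum of a directed set of Scott-continuous functions. -/
noncomputable def sup [Preorder X] [CompletePartialOrder Y] (D : Set (ScottMap X Y))
    (hD : DirectedOn (· ≤ ·) D) : ScottMap X Y :=
  have hdir : ∀ x, DirectedOn (· ≤ ·) ((fun f : ScottMap X Y => f x) '' D) := fun x =>
    directed_image (fun _ _ h => le_apply h x) hD
  ⟨fun x => sSup ((fun f : ScottMap X Y => f x) '' D), scott_of
    (fun x y hxy => (hdir x).sSup_le (by
      rintro _ ⟨f, hf, rfl⟩
      exact (f.mono hxy).trans ((hdir y).le_sSup ⟨f, hf, rfl⟩)))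
    (fun E s hne hE hs u hu => (hdir s).sSup_le (by
      rintro _ ⟨f, hf, rfl⟩
      exact f.map_le hne hE hs fun x hx => ((hdir x).le_sSup ⟨f, hf, rfl⟩).trans (hu x hx)))⟩

theorem isLUB_sup_apply [Preorder X] [CompletePartialOrder Y] (D : Set (ScottMap X Y))
    (hD : DirectedOn (· ≤ ·) D) (x : X) :
    IsLUB ((fun f : ScottMap X Y => f x) '' D) (sup D hD x) :=
  (directed_image (fun _ _ h => le_apply h x) hD).isLUB_sSup

theorem isLUB_sup [Preorder X] [CompletePartialOrder Y] (D : Set (ScottMap X Y))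
    (hD : DirectedOn (· ≤ ·) D) : IsLUB D (sup D hD) :=
  ⟨fun f hf x => (isLUB_sup_apply D hD x).1 ⟨f, hf, rfl⟩,
    fun g hg x => (isLUB_sup_apply D hD x).2 (by rintro _ ⟨f, hf, rfl⟩; exact hg hf x)⟩

/-- Directed suprema of Scott-continuous functions are computed pointwise. -/
theorem isLUB_apply [Preorder X] [CompletePartialOrder Y] {D : Set (ScottMap X Y)}
    (hD : DirectedOn (· ≤ ·) D) {s : ScottMap X Y} (hs : IsLUB D s) (x : X) :
    IsLUB ((fun f : ScottMap X Y => f x) '' D) (s x) := by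
  rw [hs.unique (isLUB_sup D hD)]
  exact isLUB_sup_apply D hD x

noncomputable instance [Preorder X] [CompletePartialOrder Y] :
    CompletePartialOrder (ScottMap X Y) :=
  cpoOfExists _ ⟨fun _ => ⊥, ScottContinuous.const ⊥⟩ (fun _ _ => bot_le)
    (fun D _ hD => ⟨_, isLUB_sup D hD⟩)

end ScottMap

/-! ## Embedding-projection pairs -/

/-- An embedding-projection pair from `X` to `Y`: Scott-continuous `emb : X → Y` and
`proj : Y → X` with `proj ∘ emb = id` and `emb ∘ proj ≤ id`. -/
structure EP (X Y : Cpo) where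
  emb : ScottMap X Y
  proj : ScottMap Y X
  proj_emb : ∀ x, proj (emb x) = x
  emb_proj : ∀ y, emb (proj y) ≤ y

/-- The embedding is determined by the projection. -/
theorem EP.ext_proj {X Y : Cpo} {f g : EP X Y} (h : ∀ y, f.proj y = g.proj y) : f = g := by
  have key : ∀ (f g : EP X Y), (∀ y, f.proj y = g.proj y) → ∀ x, f.emb x ≤ g.emb x := by
    intro f g h x
    calc f.emb x = f.emb (g.proj (g.emb x)) := by rw [g.proj_emb]
      _ = f.emb (f.proj (g.emb x)) := by rw [h]
      _ ≤ g.emb x := f.emb_proj _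
  have h1 : f.emb = g.emb :=
    ScottMap.ext fun x => le_antisymm (key f g h x) (key g f (fun y => (h y).symm) x)
  have h2 : f.proj = g.proj := ScottMap.ext h
  cases f; cases g; cases h1; cases h2; rfl

/-- The category whose objects are cpos and whose morphisms are embedding-projection pairs. -/
instance : Category Cpo where
  Hom := EP
  id X := ⟨.id X, .id X, fun _ => rfl, fun _ => le_rfl⟩
  comp f g := ⟨g.emb.comp f.emb, f.proj.comp g.proj,
    fun x => by simp [g.proj_emb, f.proj_emb],
    fun y => (g.emb.mono (f.emb_proj _)).trans (g.emb_proj y)⟩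

theorem ep_ext {X Y : Cpo} {f g : X ⟶ Y} (h : ∀ y, f.proj y = g.proj y) : f = g := EP.ext_proj h

@[simp] theorem id_proj (X : Cpo) (x : X) : EP.proj (𝟙 X) x = x := rfl
@[simp] theorem id_emb (X : Cpo) (x : X) : EP.emb (𝟙 X) x = x := rfl
@[simp] theorem comp_proj {X Y Z : Cpo} (f : X ⟶ Y) (g : Y ⟶ Z) (z : Z) :
    (f ≫ g).proj z = f.proj (g.proj z) := rfl
@[simp] theorem comp_emb {X Y Z : Cpo} (f : X ⟶ Y) (g : Y ⟶ Z) (x : X) :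
    (f ≫ g).emb x = g.emb (f.emb x) := rfl

theorem proj_bot {X Y : Cpo} (f : X ⟶ Y) : f.proj ⊥ = ⊥ :=
  le_bot_iff.1 ((f.proj.mono bot_le).trans_eq (f.proj_emb ⊥))

/-! ## The functors that interpret the type constructors -/

/-- The one-point cpo. -/
noncomputable def one : Cpo :=
  letI := cpoOfExists Unit () (fun _ => le_rfl) (fun _ _ _ => ⟨(), fun _ _ => le_rfl, fun _ _ => le_rfl⟩)
  ⟨Unit⟩

instance : Subsingleton one := inferInstanceAs (Subsingleton Unit)

/-- The one-point cpo is initial for embedding-projection pairs. -/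
noncomputable def fromOne (X : Cpo) : one ⟶ X :=
  ⟨⟨fun _ => ⊥, ScottContinuous.const ⊥⟩, ⟨fun _ => ⊥, ScottContinuous.const ⊥⟩,
    fun _ => Subsingleton.elim _ _, fun _ => bot_le⟩

theorem fromOne_unique {X : Cpo} (f g : one ⟶ X) : f = g := ep_ext fun _ => Subsingleton.elim _ _

/-- The two-point cpo `{⊥, ⊤}` (as `Prop`, with `⊥ = False` and `⊤ = True`). -/
def two : Cpo := ⟨Prop⟩

/-- Binary products, with the component-wise order. -/
noncomputable def prodObj (X Y : Cpo) : Cpo :=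
  letI : CompletePartialOrder (X × Y) := cpoOfExists (X × Y) (⊥, ⊥) (fun _ => ⟨bot_le, bot_le⟩)
    (fun D _ hD => ⟨(sSup (Prod.fst '' D), sSup (Prod.snd '' D)), isLUB_prod.2
      ⟨(ScottMap.directed_image monotone_fst hD).isLUB_sSup,
        (ScottMap.directed_image monotone_snd hD).isLUB_sSup⟩⟩)
  ⟨X × Y⟩

/-- The action of the product on a pair of Scott-continuous functions. -/
def prodMap {X X' Y Y' : Cpo} (f : ScottMap X X') (g : ScottMap Y Y') :
    ScottMap (prodObj X Y) (prodObj X' Y') where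
  toFun p := (f p.1, g p.2)
  cont := ScottContinuous.prodMk
    (ScottContinuous.comp (f := Prod.fst) (g := f) ScottContinuous.fst f.cont)
    (ScottContinuous.comp (f := Prod.snd) (g := g) ScottContinuous.snd g.cont)

/-- Binary products as a functor on embedding-projection pairs. -/
noncomputable def prodF : Cpo × Cpo ⥤ Cpo where
  obj P := prodObj P.1 P.2
  map f := ⟨prodMap f.1.emb f.2.emb, prodMap f.1.proj f.2.proj,
    fun _ => Prod.ext (f.1.proj_emb _) (f.2.proj_emb _),
    fun _ => ⟨f.1.emb_proj _, f.2.emb_proj _⟩⟩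
  map_id _ := rfl
  map_comp _ _ := rfl

/-- The cpo of Scott-continuous functions, with the pointwise order. -/
noncomputable def arrowObj (X Y : Cpo) : Cpo := ⟨ScottMap X Y⟩

/-- The mixed-variance action of the function space: `h ↦ g ∘ h ∘ f`. -/
def arrowMap {X X' Y Y' : Cpo} (f : ScottMap X' X) (g : ScottMap Y Y') :
    ScottMap (arrowObj X Y) (arrowObj X' Y') where
  toFun h := g.comp (ScottMap.comp h f)
  cont := by
    refine ScottMap.scott_of (fun h h' hh x => g.mono (ScottMap.le_apply hh (f x))) ?_
    intro D s hne hD hs u hu x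
    refine g.map_le (D := (fun h : ScottMap X Y => h (f x)) '' D) (hne.image _)
      (ScottMap.directed_image (fun _ _ h => ScottMap.le_apply h (f x)) hD) (ScottMap.isLUB_apply hD hs (f x)) ?_
    rintro _ ⟨h, hh, rfl⟩
    exact hu h hh x

/-- The function space as a (covariant) functor on embedding-projection pairs. -/
noncomputable def arrowF : Cpo × Cpo ⥤ Cpo where
  obj P := arrowObj P.1 P.2
  map f := ⟨arrowMap f.1.proj f.2.emb, arrowMap f.1.emb f.2.proj,
    fun h => ScottMap.ext fun x => by
      change f.2.proj (f.2.emb (ScottMap.toFun h (f.1.proj (f.1.emb x)))) = ScottMap.toFun h x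
      rw [f.2.proj_emb, f.1.proj_emb],
    fun h x => (f.2.emb_proj _).trans (ScottMap.mono h (f.1.emb_proj x))⟩
  map_id _ := rfl
  map_comp _ _ := rfl

theorem sum_exists_lub (X Y : Cpo) (D : Set (WithBot (X ⊕ Y))) (hD : DirectedOn (· ≤ ·) D) :
    ∃ s, IsLUB D s := by
  by_cases hl : ∃ x : X, ((Sum.inl x : X ⊕ Y) : WithBot (X ⊕ Y)) ∈ D
  · obtain ⟨x₀, hx₀⟩ := hl
    have hdir : DirectedOn (· ≤ ·) {x : X | ((Sum.inl x : X ⊕ Y) : WithBot (X ⊕ Y)) ∈ D} := by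
      intro a ha b hb
      obtain ⟨c, hc, hac, hbc⟩ := hD _ ha _ hb
      induction c using WithBot.recBotCoe with
      | bot => simp at hac
      | coe c =>
        rcases c with c | c
        · exact ⟨c, hc, by simpa using hac, by simpa using hbc⟩
        · simp at hac
    refine ⟨((Sum.inl (sSup {x : X | ((Sum.inl x : X ⊕ Y) : WithBot (X ⊕ Y)) ∈ D}) : X ⊕ Y) :
      WithBot (X ⊕ Y)), ?_, ?_⟩
    · intro c hc
      obtain ⟨e, he, h1, h2⟩ := hD _ hx₀ _ hc
      induction c using WithBot.recBotCoe with
      | bot => exact bot_le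
      | coe c =>
        induction e using WithBot.recBotCoe with
        | bot => simp at h1
        | coe e =>
          rcases e with e | e
          · rcases c with c | c
            · simpa using hdir.le_sSup hc
            · simp at h2
          · simp at h1
    · intro u hu
      induction u using WithBot.recBotCoe with
      | bot => simpa using hu hx₀
      | coe u =>
        rcases u with u | u
        · have : sSup {x : X | ((Sum.inl x : X ⊕ Y) : WithBot (X ⊕ Y)) ∈ D} ≤ u :=
            hdir.sSup_le fun x hx => by simpa using hu hx
          simpa using this
        · simpa using hu hx₀
  · by_cases hr : ∃ y : Y, ((Sum.inr y : X ⊕ Y) : WithBot (X ⊕ Y)) ∈ D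
    · obtain ⟨y₀, hy₀⟩ := hr
      have hdir : DirectedOn (· ≤ ·) {y : Y | ((Sum.inr y : X ⊕ Y) : WithBot (X ⊕ Y)) ∈ D} := by
        intro a ha b hb
        obtain ⟨c, hc, hac, hbc⟩ := hD _ ha _ hb
        induction c using WithBot.recBotCoe with
        | bot => simp at hac
        | coe c =>
          rcases c with c | c
          · simp at hac
          · exact ⟨c, hc, by simpa using hac, by simpa using hbc⟩
      refine ⟨((Sum.inr (sSup {y : Y | ((Sum.inr y : X ⊕ Y) : WithBot (X ⊕ Y)) ∈ D}) : X ⊕ Y) :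
        WithBot (X ⊕ Y)), ?_, ?_⟩
      · intro c hc
        induction c using WithBot.recBotCoe with
        | bot => exact bot_le
        | coe c =>
          rcases c with c | c
          · exact absurd ⟨c, hc⟩ hl
          · simpa using hdir.le_sSup hc
      · intro u hu
        induction u using WithBot.recBotCoe with
        | bot => simpa using hu hy₀
        | coe u =>
          rcases u with u | u
          · simpa using hu hy₀
          · have : sSup {y : Y | ((Sum.inr y : X ⊕ Y) : WithBot (X ⊕ Y)) ∈ D} ≤ u :=
              hdir.sSup_le fun x hx => by simpa using hu hx
            simpa using this
    · refine ⟨⊥, ?_, fun _ _ => bot_le⟩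
      intro c hc
      induction c using WithBot.recBotCoe with
      | bot => exact bot_le
      | coe c =>
        rcases c with c | c
        · exact absurd ⟨c, hc⟩ hl
        · exact absurd ⟨c, hc⟩ hr

/-- The weak sum: the disjoint union of `X` and `Y`, with a new least element. -/
noncomputable def sumObj (X Y : Cpo) : Cpo :=
  letI : CompletePartialOrder (WithBot (X ⊕ Y)) := cpoOfExists _ ⊥ (fun _ => bot_le)
    (fun D _ hD => sum_exists_lub X Y D hD)
  ⟨WithBot (X ⊕ Y)⟩

/-- The first injection into the weak sum. -/
def sumInl {X Y : Cpo} (x : X) : sumObj X Y := ((Sum.inl x : X ⊕ Y) : WithBot (X ⊕ Y))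

/-- The second injection into the weak sum. -/
def sumInr {X Y : Cpo} (y : Y) : sumObj X Y := ((Sum.inr y : X ⊕ Y) : WithBot (X ⊕ Y))

theorem sum_map_cont {X X' Y Y' : Cpo} (f : ScottMap X X') (g : ScottMap Y Y') :
    ScottContinuous (WithBot.map (Sum.map f g)) := by
  have hmono : Monotone (WithBot.map (Sum.map f g)) :=
    Monotone.withBot_map fun a b h => by
      rcases a with a | a <;> rcases b with b | b
      · simpa using f.mono (by simpa using h)
      · simp at h
      · simp at h
      · simpa using g.mono (by simpa using h)
  refine ScottMap.scott_of hmono ?_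
  intro D s hne hD hs u hu
  induction s using WithBot.recBotCoe with
  | bot => exact bot_le
  | coe s =>
    rcases s with s | s
    · have hD' : ∀ c ∈ D, c = ⊥ ∨ ∃ x : X, c = ((Sum.inl x : X ⊕ Y) : WithBot (X ⊕ Y)) := by
        intro c hc
        have := hs.1 hc
        induction c using WithBot.recBotCoe with
        | bot => exact Or.inl rfl
        | coe c =>
          rcases c with c | c
          · exact Or.inr ⟨c, rfl⟩
          · simp at this
      have hex : ∃ x : X, ((Sum.inl x : X ⊕ Y) : WithBot (X ⊕ Y)) ∈ D := by
        by_contra hno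
        have : ((Sum.inl s : X ⊕ Y) : WithBot (X ⊕ Y)) ≤ ⊥ := hs.2 fun c hc => by
          rcases hD' c hc with rfl | ⟨x, rfl⟩
          · exact le_rfl
          · exact absurd ⟨x, hc⟩ hno
        simp at this
      have hlub : IsLUB {x : X | ((Sum.inl x : X ⊕ Y) : WithBot (X ⊕ Y)) ∈ D} s := by
        refine ⟨fun x hx => by simpa using hs.1 hx, fun v hv => ?_⟩
        have : ((Sum.inl s : X ⊕ Y) : WithBot (X ⊕ Y)) ≤ ((Sum.inl v : X ⊕ Y) : WithBot (X ⊕ Y)) :=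
          hs.2 fun c hc => by
            rcases hD' c hc with rfl | ⟨x, rfl⟩
            · exact bot_le
            · simpa using hv hc
        simpa using this
      have hdir : DirectedOn (· ≤ ·) {x : X | ((Sum.inl x : X ⊕ Y) : WithBot (X ⊕ Y)) ∈ D} := by
        intro a ha b hb
        obtain ⟨c, hc, hac, hbc⟩ := hD _ ha _ hb
        rcases hD' c hc with rfl | ⟨x, rfl⟩
        · simp at hac
        · exact ⟨x, hc, by simpa using hac, by simpa using hbc⟩
      obtain ⟨x₀, hx₀⟩ := hex
      have hu₀ := hu _ hx₀
      induction u using WithBot.recBotCoe with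
      | bot => simp at hu₀
      | coe u =>
        rcases u with u | u
        · have : f s ≤ u := f.map_le ⟨x₀, hx₀⟩ hdir hlub fun x hx => by simpa using hu _ hx
          simpa using this
        · simp at hu₀
    · have hD' : ∀ c ∈ D, c = ⊥ ∨ ∃ y : Y, c = ((Sum.inr y : X ⊕ Y) : WithBot (X ⊕ Y)) := by
        intro c hc
        have := hs.1 hc
        induction c using WithBot.recBotCoe with
        | bot => exact Or.inl rfl
        | coe c =>
          rcases c with c | c
          · simp at this
          · exact Or.inr ⟨c, rfl⟩
      have hex : ∃ y : Y, ((Sum.inr y : X ⊕ Y) : WithBot (X ⊕ Y)) ∈ D := by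
        by_contra hno
        have : ((Sum.inr s : X ⊕ Y) : WithBot (X ⊕ Y)) ≤ ⊥ := hs.2 fun c hc => by
          rcases hD' c hc with rfl | ⟨x, rfl⟩
          · exact le_rfl
          · exact absurd ⟨x, hc⟩ hno
        simp at this
      have hlub : IsLUB {y : Y | ((Sum.inr y : X ⊕ Y) : WithBot (X ⊕ Y)) ∈ D} s := by
        refine ⟨fun x hx => by simpa using hs.1 hx, fun v hv => ?_⟩
        have : ((Sum.inr s : X ⊕ Y) : WithBot (X ⊕ Y)) ≤ ((Sum.inr v : X ⊕ Y) : WithBot (X ⊕ Y)) :=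
          hs.2 fun c hc => by
            rcases hD' c hc with rfl | ⟨x, rfl⟩
            · exact bot_le
            · simpa using hv hc
        simpa using this
      have hdir : DirectedOn (· ≤ ·) {y : Y | ((Sum.inr y : X ⊕ Y) : WithBot (X ⊕ Y)) ∈ D} := by
        intro a ha b hb
        obtain ⟨c, hc, hac, hbc⟩ := hD _ ha _ hb
        rcases hD' c hc with rfl | ⟨x, rfl⟩
        · simp at hac
        · exact ⟨x, hc, by simpa using hac, by simpa using hbc⟩
      obtain ⟨x₀, hx₀⟩ := hex
      have hu₀ := hu _ hx₀
      induction u using WithBot.recBotCoe with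
      | bot => simp at hu₀
      | coe u =>
        rcases u with u | u
        · simp at hu₀
        · have : g s ≤ u := g.map_le ⟨x₀, hx₀⟩ hdir hlub fun x hx => by simpa using hu _ hx
          simpa using this

/-- The action of the weak sum on a pair of Scott-continuous functions. -/
def sumMap {X X' Y Y' : Cpo} (f : ScottMap X X') (g : ScottMap Y Y') :
    ScottMap (sumObj X Y) (sumObj X' Y') where
  toFun := WithBot.map (Sum.map f g)
  cont := sum_map_cont f g

/-- The weak sum as a functor on embedding-projection pairs. -/
noncomputable def sumF : Cpo × Cpo ⥤ Cpo where
  obj P := sumObj P.1 P.2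
  map f := ⟨sumMap f.1.emb f.2.emb, sumMap f.1.proj f.2.proj,
    fun p => by
      change WithBot.map _ (WithBot.map _ p) = p
      induction p using WithBot.recBotCoe with
      | bot => rfl
      | coe p => rcases p with p | p <;> simp [EP.proj_emb],
    fun p => by
      change WithBot.map _ (WithBot.map _ p) ≤ p
      induction p using WithBot.recBotCoe with
      | bot => exact bot_le
      | coe p => rcases p with p | p <;> simp [EP.emb_proj]⟩
  map_id P := ep_ext fun p => by
    change WithBot.map _ p = p
    induction p using WithBot.recBotCoe with
    | bot => rfl
    | coe p => rcases p with p | p <;> rfl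
  map_comp f g := ep_ext fun p => by
    change WithBot.map _ p = WithBot.map _ (WithBot.map _ p)
    induction p using WithBot.recBotCoe with
    | bot => rfl
    | coe p => rcases p with p | p <;> rfl

/-! ## Colimits of ω-chains of embedding-projection pairs -/

section Bilimit

variable (F : ℕ ⥤ Cpo)

/-- Compatible sequences: the limit of the projections of the chain `F`. -/
def BilimType : Type :=
  {x : ∀ n, F.obj n // ∀ i j (h : i ≤ j), (F.map (homOfLE h)).proj (x j) = x i}

instance : PartialOrder (BilimType F) := inferInstanceAs (PartialOrder (Subtype _))

variable {F}

theorem bilim_directed {D : Set (BilimType F)} (hD : DirectedOn (· ≤ ·) D) (n : ℕ) :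
    DirectedOn (· ≤ ·) ((fun x : BilimType F => x.1 n) '' D) :=
  ScottMap.directed_image (fun x y h => (show ∀ n, x.1 n ≤ y.1 n from h) n) hD

/-- The pointwise supremum of a directed set of compatible sequences. -/
noncomputable def bilimSup (D : Set (BilimType F)) (hne : D.Nonempty)
    (hD : DirectedOn (· ≤ ·) D) : BilimType F :=
  ⟨fun n => sSup ((fun x : BilimType F => x.1 n) '' D), fun i j h => by
    have h1 := (F.map (homOfLE h)).proj.cont (hne.image _) (bilim_directed hD j)
      (bilim_directed hD j).isLUB_sSup
    rw [Set.image_image] at h1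
    have h2 : (fun x : BilimType F => (F.map (homOfLE h)).proj (x.1 j)) = fun x => x.1 i :=
      funext fun x => x.2 i j h
    have h3 : IsLUB ((fun x : BilimType F => (F.map (homOfLE h)).proj (x.1 j)) '' D)
      ((F.map (homOfLE h)).proj (sSup ((fun x : BilimType F => x.1 j) '' D))) := h1
    rw [h2] at h3
    exact h3.unique (bilim_directed hD i).isLUB_sSup⟩

theorem bilimSup_isLUB (D : Set (BilimType F)) (hne : D.Nonempty) (hD : DirectedOn (· ≤ ·) D) :
    IsLUB D (bilimSup D hne hD) :=
  ⟨fun x hx n => (bilim_directed hD n).le_sSup ⟨x, hx, rfl⟩,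
    fun u hu n => (bilim_directed hD n).sSup_le (by rintro _ ⟨x, hx, rfl⟩; exact hu hx n)⟩

theorem bilim_isLUB_apply {D : Set (BilimType F)} (hne : D.Nonempty) (hD : DirectedOn (· ≤ ·) D)
    {s : BilimType F} (hs : IsLUB D s) (n : ℕ) :
    IsLUB ((fun x : BilimType F => x.1 n) '' D) (s.1 n) := by
  rw [hs.unique (bilimSup_isLUB D hne hD)]
  exact (bilim_directed hD n).isLUB_sSup

variable (F)

/-- The limit of the projections of `F`, with the pointwise order. -/
noncomputable def bilimObj : Cpo :=
  letI := cpoOfExists (BilimType F) ⟨fun _ => ⊥, fun _ _ _ => proj_bot _⟩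
    (fun _ _ => bot_le) (fun D hne hD => ⟨_, bilimSup_isLUB D hne hD⟩)
  ⟨BilimType F⟩

variable {F}

theorem through_indep {n m k l : ℕ} (hn : n ≤ k) (hm : m ≤ k) (hk : k ≤ l) (x : F.obj n) :
    (F.map (homOfLE (hm.trans hk))).proj ((F.map (homOfLE (hn.trans hk))).emb x) =
      (F.map (homOfLE hm)).proj ((F.map (homOfLE hn)).emb x) := by
  rw [← homOfLE_comp hm hk, ← homOfLE_comp hn hk, F.map_comp, F.map_comp, comp_proj, comp_emb,
    EP.proj_emb]

/-- Embed `F n` into `F k` and project to `F m`; this does not depend on `k ≥ n, m`. -/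
def through (n m : ℕ) (x : F.obj n) : F.obj m :=
  (F.map (homOfLE (le_max_right n m))).proj ((F.map (homOfLE (le_max_left n m))).emb x)

theorem through_eq {n m k : ℕ} (hn : n ≤ k) (hm : m ≤ k) (x : F.obj n) :
    through n m x = (F.map (homOfLE hm)).proj ((F.map (homOfLE hn)).emb x) :=
  (through_indep (le_max_left n m) (le_max_right n m) (max_le hn hm) x).symm

variable (F)

/-- The embedding-projection pair from `F n` to the limit: its projection part is the `n`-th
coordinate. -/
noncomputable def bilimIn (n : ℕ) : F.obj n ⟶ bilimObj F where
  emb := ⟨fun x => ⟨fun m => through n m x, fun i j h => by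
      change (F.map (homOfLE h)).proj (through n j x) = through n i x
      rw [through_eq (le_max_left n j) (h.trans (le_max_right n j)), through,
        ← homOfLE_comp h (le_max_right n j), F.map_comp, comp_proj]⟩,
    ScottMap.scott_of (fun x y h m => (EP.proj _).mono ((EP.emb _).mono h))
      (fun D s hne hD hs u hu m =>
        ((F.map (homOfLE (le_max_right n m))).proj.comp
          (F.map (homOfLE (le_max_left n m))).emb).map_le hne hD hs fun x hx => hu x hx m)⟩
  proj := ⟨fun x => x.1 n, ScottMap.scott_of (fun _ _ h => h n) fun D s hne hD hs u hu =>
      (bilim_isLUB_apply hne hD hs n).2 (by rintro _ ⟨x, hx, rfl⟩; exact hu x hx)⟩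
  proj_emb x := by
    change through n n x = x
    rw [through_eq le_rfl le_rfl, EP.proj_emb]
  emb_proj x m := by
    change through n m (x.1 n) ≤ x.1 m
    rw [through, ← x.2 n _ (le_max_left n m), ← x.2 m _ (le_max_right n m)]
    exact (EP.proj _).mono (EP.emb_proj _ _)

@[simp] theorem bilimIn_proj (n : ℕ) (x : bilimObj F) : (bilimIn F n).proj x = x.1 n := rfl

/-- The cocone of the `bilimIn F n`. -/
noncomputable def bilimCocone : Limits.Cocone F where
  pt := bilimObj F
  ι :=
    { app := bilimIn F
      naturality := fun i j f => ep_ext fun x => x.2 i j (leOfHom f) }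

variable {F}

/-- The components of a cocone. -/
def leg (s : Limits.Cocone F) (n : ℕ) : F.obj n ⟶ s.pt := s.ι.app n

theorem leg_w (s : Limits.Cocone F) {i j : ℕ} (h : i ≤ j) :
    F.map (homOfLE h) ≫ leg s j = leg s i := s.w (homOfLE h)

theorem cocone_proj (s : Limits.Cocone F) {i j : ℕ} (h : i ≤ j) (y : s.pt) :
    (F.map (homOfLE h)).proj ((leg s j).proj y) = (leg s i).proj y := by
  rw [← comp_proj, leg_w]

theorem cocone_emb_mono (s : Limits.Cocone F) (x : BilimType F) :
    Monotone fun n => (leg s n).emb (x.1 n) := by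
  intro i j h
  change (leg s i).emb (x.1 i) ≤ (leg s j).emb (x.1 j)
  rw [← leg_w s h, comp_emb, ← x.2 i j h]
  exact (EP.emb _).mono (EP.emb_proj _ _)

theorem cocone_emb_directed (s : Limits.Cocone F) (x : BilimType F) :
    DirectedOn (· ≤ ·) (Set.range fun n => (leg s n).emb (x.1 n)) :=
  (cocone_emb_mono s x).directed_le.directedOn_range

/-- The mediating morphism to a cocone `τ`: its embedding part is `x ↦ ⨆ n, τₙ (xₙ)`. -/
noncomputable def bilimDesc (s : Limits.Cocone F) : bilimObj F ⟶ s.pt where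
  emb := ⟨fun x => sSup (Set.range fun n => (leg s n).emb (x.1 n)), ScottMap.scott_of
    (fun x y h => (cocone_emb_directed s x).sSup_le (by
      rintro _ ⟨n, rfl⟩
      exact ((leg s n).emb.mono (h n)).trans ((cocone_emb_directed s y).le_sSup ⟨n, rfl⟩)))
    (fun D t hne hD ht u hu => (cocone_emb_directed s t).sSup_le (by
      rintro _ ⟨n, rfl⟩
      refine (leg s n).emb.map_le (hne.image _) (bilim_directed hD n)
        (bilim_isLUB_apply hne hD ht n) ?_
      rintro _ ⟨x, hx, rfl⟩
      exact ((cocone_emb_directed s x).le_sSup ⟨n, rfl⟩).trans (hu x hx)))⟩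
  proj := ⟨fun y => ⟨fun n => (leg s n).proj y, fun i j h => cocone_proj s h y⟩,
    ScottMap.scott_of (fun x y h n => (leg s n).proj.mono h)
      fun D t hne hD ht u hu n => (leg s n).proj.map_le hne hD ht fun x hx => hu x hx n⟩
  proj_emb x := by
    refine Subtype.ext (funext fun m => ?_)
    change (leg s m).proj (sSup (Set.range fun n => (leg s n).emb (x.1 n))) = x.1 m
    apply le_antisymm
    · refine (leg s m).proj.map_le (Set.range_nonempty _) (cocone_emb_directed s x)
        (cocone_emb_directed s x).isLUB_sSup ?_
      rintro _ ⟨n, rfl⟩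
      refine ((leg s m).proj.mono (cocone_emb_mono s x (le_max_left n m))).trans_eq ?_
      change (leg s m).proj ((leg s (max n m)).emb (x.1 (max n m))) = x.1 m
      rw [← cocone_proj s (le_max_right n m), EP.proj_emb, x.2]
    · calc x.1 m = (leg s m).proj ((leg s m).emb (x.1 m)) := ((leg s m).proj_emb _).symm
        _ ≤ _ := (leg s m).proj.mono ((cocone_emb_directed s x).le_sSup ⟨m, rfl⟩)
  emb_proj y := (cocone_emb_directed s _).sSup_le (by
    rintro _ ⟨n, rfl⟩
    exact (leg s n).emb_proj y)

variable (F)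

/-- The limit of the projections is a colimit of the chain of embedding-projection pairs. -/
noncomputable def bilimIsColimit : Limits.IsColimit (bilimCocone F) where
  desc := bilimDesc
  fac _ _ := ep_ext fun _ => rfl
  uniq s m hm := ep_ext fun y => Subtype.ext (funext fun n => by
    change (m.proj y).1 n = (s.ι.app n).proj y
    rw [← hm n]
    rfl)

end Bilimit

/-- Colimits of ω-chains as a functor. -/
noncomputable def bilim : (ℕ ⥤ Cpo) ⥤ Cpo where
  obj F := bilimObj F
  map {_ G} α := bilimDesc ⟨bilimObj G, α ≫ (bilimCocone G).ι⟩
  map_id _ := ep_ext fun _ => rfl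
  map_comp _ _ := ep_ext fun _ => rfl

/-! ## Solutions of recursive domain equations -/

section Fix

universe v u

variable {B : Type u} [Category.{v} B] (G : B × Cpo ⥤ Cpo)

/-- The iterates `G(b, -)ⁿ(1)`. -/
noncomputable def iterObj (b : B) (n : ℕ) : Cpo :=
  Nat.rec one (fun _ X => G.obj (b, X)) n

/-- The connecting morphisms `G(b, -)ⁿ(1) ⟶ G(b, -)ⁿ⁺¹(1)`. -/
noncomputable def iterStep (b : B) : ∀ n, iterObj G b n ⟶ iterObj G b (n + 1)
  | 0 => fromOne _
  | n + 1 => G.map (Prod.mkHom (𝟙 b) (iterStep b n))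

/-- The action of a morphism `f` of parameters on the iterates. -/
noncomputable def iterMap {b b' : B} (f : b ⟶ b') : ∀ n, iterObj G b n ⟶ iterObj G b' n
  | 0 => 𝟙 one
  | n + 1 => G.map (Prod.mkHom f (iterMap f n))

theorem iterMap_naturality {b b' : B} (f : b ⟶ b') (n : ℕ) :
    iterStep G b n ≫ iterMap G f (n + 1) = iterMap G f n ≫ iterStep G b' n := by
  induction n with
  | zero => exact fromOne_unique _ _
  | succ n ih =>
    change G.map _ ≫ G.map _ = G.map _ ≫ G.map _
    rw [← G.map_comp, ← G.map_comp]
    congr 1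
    refine Prod.ext ?_ ?_
    · simp
    · exact ih

/-- The ω-chain `1 ⟶ G(b, 1) ⟶ G(b, G(b, 1)) ⟶ ⋯`, as a functor of `b`. -/
noncomputable def iterChain : B ⥤ (ℕ ⥤ Cpo) where
  obj b := Functor.ofSequence (iterStep G b)
  map {b b'} f := NatTrans.ofSequence (F := Functor.ofSequence (iterStep G b))
    (G := Functor.ofSequence (iterStep G b')) (iterMap G f) (fun n => by
      rw [Functor.ofSequence_map_homOfLE_succ, Functor.ofSequence_map_homOfLE_succ]
      exact iterMap_naturality G f n)
  map_id b := by
    ext n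
    change iterMap G (𝟙 b) n = 𝟙 _
    induction n with
    | zero => rfl
    | succ n ih =>
      change G.map _ = 𝟙 _
      rw [ih]
      exact G.map_id _
  map_comp f g := by
    ext n
    change iterMap G (f ≫ g) n = iterMap G f n ≫ iterMap G g n
    induction n with
    | zero => rfl
    | succ n ih =>
      change G.map _ = G.map _ ≫ G.map _
      rw [ih, ← G.map_comp]
      rfl

/-- The functor `b ↦ colim (1 ⟶ G(b, 1) ⟶ G(b, G(b, 1)) ⟶ ⋯)`. -/
noncomputable def fixF : B ⥤ Cpo := iterChain G ⋙ bilim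

/-- The cocone over the iterates with vertex `G(b, Fix G b)`. -/
noncomputable def unfoldCocone (b : B) : Limits.Cocone ((iterChain G).obj b) where
  pt := G.obj (b, (fixF G).obj b)
  ι := NatTrans.ofSequence (F := (iterChain G).obj b)
    (G := (Functor.const ℕ).obj (G.obj (b, (fixF G).obj b)))
    (fun n => match n with
      | 0 => fromOne _
      | n + 1 => G.map (Prod.mkHom (𝟙 b) (bilimIn ((iterChain G).obj b) n)))
    (fun n => match n with
      | 0 => fromOne_unique _ _
      | n + 1 => by
        have h := (bilimCocone ((iterChain G).obj b)).w (homOfLE (n.le_add_right 1))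
        have h1 := Functor.ofSequence_map_homOfLE_succ (iterStep G b) (n + 1)
        have h2 := Functor.ofSequence_map_homOfLE_succ (iterStep G b) n
        change (Functor.ofSequence (iterStep G b)).map _ ≫ bilimIn _ _ = bilimIn _ _ at h
        rw [h2] at h
        refine Eq.trans ?_ (Category.comp_id _).symm
        refine (congrArg (· ≫ G.map (Prod.mkHom (𝟙 b) (bilimIn ((iterChain G).obj b) (n + 1)))) h1).trans ?_
        change G.map (Prod.mkHom (𝟙 b) (iterStep G b n)) ≫
          G.map (Prod.mkHom (𝟙 b) (bilimIn ((iterChain G).obj b) (n + 1))) =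
          G.map (Prod.mkHom (𝟙 b) (bilimIn ((iterChain G).obj b) n))
        rw [← G.map_comp]
        congr 1
        refine Prod.ext ?_ ?_
        · simp
        · exact h)

/-- The canonical morphism `Fix G b ⟶ G(b, Fix G b)` given by the universal property of the
colimit `Fix G b`. It is an isomorphism when `G(b, -)` preserves colimits of ω-chains. -/
noncomputable def unfoldEP (b : B) : (fixF G).obj b ⟶ G.obj (b, (fixF G).obj b) :=
  (bilimIsColimit ((iterChain G).obj b)).desc (unfoldCocone G b)

variable {B' : Type u} [Category.{v} B'] (H : B' ⥤ B)

theorem iterStep_precomp (b : B') :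
    iterStep (H.prod (𝟭 Cpo) ⋙ G) b = iterStep G (H.obj b) := by
  funext n
  induction n with
  | zero => rfl
  | succ n ih =>
    change G.map (Prod.mkHom (H.map (𝟙 b)) (iterStep (H.prod (𝟭 Cpo) ⋙ G) b n)) =
      G.map (Prod.mkHom (𝟙 (H.obj b)) (iterStep G (H.obj b) n))
    rw [ih, H.map_id]
    rfl

theorem iterMap_precomp {b b' : B'} (f : b ⟶ b') (n : ℕ) :
    iterMap (H.prod (𝟭 Cpo) ⋙ G) f n = iterMap G (H.map f) n := by
  induction n with
  | zero => rfl
  | succ n ih =>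
    change G.map (Prod.mkHom (H.map f) (iterMap (H.prod (𝟭 Cpo) ⋙ G) f n)) =
      G.map (Prod.mkHom (H.map f) (iterMap G (H.map f) n))
    rw [ih]
    rfl

theorem eqToHom_ofSequence_app {X : ℕ → Cpo} {s s' : ∀ n, X n ⟶ X (n + 1)} (h : s = s')
    (e : Functor.ofSequence s = Functor.ofSequence s') (n : ℕ) :
    (eqToHom e).app n = 𝟙 (X n) := by
  subst h
  rfl

theorem iterChain_precomp : iterChain (H.prod (𝟭 Cpo) ⋙ G) = H ⋙ iterChain G := by
  refine CategoryTheory.Functor.ext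
    (fun b => congrArg (fun s => Functor.ofSequence (X := iterObj G (H.obj b)) s)
      (iterStep_precomp G H b)) ?_
  intro b b' f
  ext n
  have h1 := eqToHom_ofSequence_app (X := iterObj G (H.obj b)) (iterStep_precomp G H b)
    (congrArg _ (iterStep_precomp G H b)) n
  have h2 := eqToHom_ofSequence_app (X := iterObj G (H.obj b')) (iterStep_precomp G H b').symm
    (congrArg _ (iterStep_precomp G H b').symm) n
  rw [NatTrans.comp_app, NatTrans.comp_app]
  refine Eq.trans ?_ (congrArg₂ (fun u v => u ≫ iterMap G (H.map f) n ≫ v) h1 h2).symm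
  refine Eq.trans ?_ (Category.id_comp _).symm
  refine Eq.trans ?_ (Category.comp_id _).symm
  exact iterMap_precomp G H f n

theorem fixF_precomp : fixF (H.prod (𝟭 Cpo) ⋙ G) = H ⋙ fixF G := by
  unfold fixF
  rw [iterChain_precomp]
  rfl

end Fix

/-! ## Pure types -/

/-- Pure type expressions with type variables `0, …, n - 1` (de Bruijn indices); `mu τ` is the
recursive type `rec X. τ`, which binds the variable `0` of `τ`. A pure type is an element of
`Ty 0`. -/
inductive Ty : ℕ → Type
  | var {n : ℕ} (i : Fin n) : Ty n
  | unit {n : ℕ} : Ty n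
  | prod {n : ℕ} (σ τ : Ty n) : Ty n
  | arrow {n : ℕ} (σ τ : Ty n) : Ty n
  | sum {n : ℕ} (σ τ : Ty n) : Ty n
  | mu {n : ℕ} (τ : Ty (n + 1)) : Ty n

namespace Ty

/-- Extend a renaming under a binder. -/
def liftRen {n m : ℕ} (ρ : Fin n → Fin m) : Fin (n + 1) → Fin (m + 1) :=
  Fin.cases 0 (fun i => (ρ i).succ)

/-- Renaming of type variables. -/
def rename : {n m : ℕ} → (Fin n → Fin m) → Ty n → Ty m
  | _, _, ρ, var i => var (ρ i)
  | _, _, _, unit => unit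
  | _, _, ρ, prod σ τ => prod (rename ρ σ) (rename ρ τ)
  | _, _, ρ, arrow σ τ => arrow (rename ρ σ) (rename ρ τ)
  | _, _, ρ, sum σ τ => sum (rename ρ σ) (rename ρ τ)
  | _, _, ρ, mu τ => mu (rename (liftRen ρ) τ)

/-- Extend a substitution under a binder. -/
def liftSub {n m : ℕ} (s : Fin n → Ty m) : Fin (n + 1) → Ty (m + 1) :=
  Fin.cases (var 0) (fun i => rename Fin.succ (s i))

/-- Simultaneous capture-avoiding substitution. -/
def subst : {n m : ℕ} → (Fin n → Ty m) → Ty n → Ty m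
  | _, _, s, var i => s i
  | _, _, _, unit => unit
  | _, _, s, prod σ τ => prod (subst s σ) (subst s τ)
  | _, _, s, arrow σ τ => arrow (subst s σ) (subst s τ)
  | _, _, s, sum σ τ => sum (subst s σ) (subst s τ)
  | _, _, s, mu τ => mu (subst (liftSub s) τ)

/-- The substitution of `σ` for the variable `0`, which leaves the other variables alone. -/
def single {n : ℕ} (σ : Ty n) : Fin (n + 1) → Ty n := Fin.cases σ var

/-- The unfolding `τ[rec X. τ / X]` of the recursive type `rec X. τ`. -/
def unfolding {n : ℕ} (τ : Ty (n + 1)) : Ty n := subst (single (mu τ)) τ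

end Ty

/-! ## Interpretation of pure types -/

/-- Extend an environment by a value for the variable `0`. -/
def consF (n : ℕ) : (Fin n → Cpo) × Cpo ⥤ (Fin (n + 1) → Cpo) :=
  Functor.pi' (Fin.cases (CategoryTheory.Prod.snd _ _)
    (fun i => CategoryTheory.Prod.fst _ _ ⋙ Pi.eval _ i))

/-- The interpretation of a type expression with `n` free variables, as a functor on
embedding-projection pairs. -/
noncomputable def interp : {n : ℕ} → Ty n → ((Fin n → Cpo) ⥤ Cpo)
  | _, .var i => Pi.eval _ i
  | _, .unit => (Functor.const _).obj two
  | _, .prod σ τ => (interp σ).prod' (interp τ) ⋙ prodF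
  | _, .arrow σ τ => (interp σ).prod' (interp τ) ⋙ arrowF
  | _, .sum σ τ => (interp σ).prod' (interp τ) ⋙ sumF
  | n, .mu τ => fixF (consF n ⋙ interp τ)

/-- The functor on environments induced by a renaming. -/
def renF {n m : ℕ} (ρ : Fin n → Fin m) : (Fin m → Cpo) ⥤ (Fin n → Cpo) :=
  Functor.pi' (fun i => Pi.eval _ (ρ i))

/-- The functor on environments induced by a substitution. -/
noncomputable def subF {n m : ℕ} (s : Fin n → Ty m) : (Fin m → Cpo) ⥤ (Fin n → Cpo) :=
  Functor.pi' (fun i => interp (s i))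

theorem cons_renF {n m : ℕ} (ρ : Fin n → Fin m) :
    consF m ⋙ renF (Ty.liftRen ρ) = (renF ρ).prod (𝟭 Cpo) ⋙ consF n :=
  Functor.pi_ext _ _ fun i => by refine Fin.cases ?_ (fun i => ?_) i <;> rfl

theorem interp_rename {n : ℕ} (τ : Ty n) : ∀ {m : ℕ} (ρ : Fin n → Fin m),
    interp (τ.rename ρ) = renF ρ ⋙ interp τ := by
  induction τ with
  | var i => intro m ρ; rfl
  | unit => intro m ρ; rfl
  | prod σ τ h1 h2 => intro m ρ; simp only [Ty.rename, interp, h1 ρ, h2 ρ]; rfl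
  | arrow σ τ h1 h2 => intro m ρ; simp only [Ty.rename, interp, h1 ρ, h2 ρ]; rfl
  | sum σ τ h1 h2 => intro m ρ; simp only [Ty.rename, interp, h1 ρ, h2 ρ]; rfl
  | mu τ h =>
    intro m ρ
    simp only [Ty.rename, interp, h (Ty.liftRen ρ)]
    rw [← Functor.assoc, cons_renF, Functor.assoc]
    exact fixF_precomp _ _

theorem cons_subF {n m : ℕ} (s : Fin n → Ty m) :
    consF m ⋙ subF (Ty.liftSub s) = (subF s).prod (𝟭 Cpo) ⋙ consF n :=
  Functor.pi_ext _ _ fun i => by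
    refine Fin.cases ?_ (fun i => ?_) i
    · rfl
    · change consF m ⋙ interp (Ty.rename Fin.succ (s i)) = _
      rw [interp_rename]
      rfl

/-- Substitution is interpreted by composition. -/
theorem interp_subst {n : ℕ} (τ : Ty n) : ∀ {m : ℕ} (s : Fin n → Ty m),
    interp (τ.subst s) = subF s ⋙ interp τ := by
  induction τ with
  | var i => intro m s; rfl
  | unit => intro m s; rfl
  | prod σ τ h1 h2 => intro m s; simp only [Ty.subst, interp, h1 s, h2 s]; rfl
  | arrow σ τ h1 h2 => intro m s; simp only [Ty.subst, interp, h1 s, h2 s]; rfl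
  | sum σ τ h1 h2 => intro m s; simp only [Ty.subst, interp, h1 s, h2 s]; rfl
  | mu τ h =>
    intro m s
    simp only [Ty.subst, interp, h (Ty.liftSub s)]
    rw [← Functor.assoc, cons_subF, Functor.assoc]
    exact fixF_precomp _ _

theorem interp_unfolding {n : ℕ} (τ : Ty (n + 1)) (X : Fin n → Cpo) :
    (consF n ⋙ interp τ).obj (X, (interp τ.mu).obj X) = (interp τ.unfolding).obj X := by
  unfold Ty.unfolding
  rw [interp_subst]
  change (interp τ).obj _ = (interp τ).obj _
  congr 1
  funext i
  refine Fin.cases ?_ (fun i => ?_) i <;> rfl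

/-- The interpretation of a pure type. -/
noncomputable def sem (τ : Ty 0) : Cpo := (interp τ).obj (fun i => i.elim0)

/-- The embedding part of the canonical morphism from `rec X. τ` to its unfolding (which is an
isomorphism, since the functors `interp τ` preserve colimits of ω-chains). The `eqToHom` only
identifies `τ[rec X. τ / X]` with the value of `τ` at `rec X. τ`. -/
noncomputable def unfold (τ : Ty 1) : ScottMap (sem τ.mu) (sem τ.unfolding) :=
  EP.emb (unfoldEP (consF 0 ⋙ interp τ) (fun i => i.elim0) ≫ eqToHom (interp_unfolding τ _))

/-! ## The logic -/

/-- The formulae of the fragment without disjunctions, fixpoints and iteration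
(but with falsity), indexed by their pure type. -/
inductive Form : Ty 0 → Type
  | top {τ : Ty 0} : Form τ
  | bot {τ : Ty 0} : Form τ
  | and {τ : Ty 0} (φ ψ : Form τ) : Form τ
  | unit : Form .unit
  | fst {σ τ : Ty 0} (φ : Form σ) : Form (.prod σ τ)
  | snd {σ τ : Ty 0} (φ : Form τ) : Form (.prod σ τ)
  | fold {τ : Ty 1} (φ : Form τ.unfolding) : Form (.mu τ)
  | inl {σ τ : Ty 0} (φ : Form σ) : Form (.sum σ τ)
  | inr {σ τ : Ty 0} (φ : Form τ) : Form (.sum σ τ)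
  | imp {σ τ : Ty 0} (ψ : Form σ) (φ : Form τ) : Form (.arrow σ τ)

/-- The interpretation of formulae. -/
noncomputable def Form.sem : {τ : Ty 0} → Form τ → Set (DomainLogic.sem τ)
  | _, .top => Set.univ
  | _, .bot => ∅
  | _, .and φ ψ => φ.sem ∩ ψ.sem
  | _, .unit => {(True : Prop)}
  | _, .fst (σ := σ) (τ := τ) φ =>
      {x : prodObj (DomainLogic.sem σ) (DomainLogic.sem τ) | x.1 ∈ φ.sem}
  | _, .snd (σ := σ) (τ := τ) φ =>
      {x : prodObj (DomainLogic.sem σ) (DomainLogic.sem τ) | x.2 ∈ φ.sem}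
  | _, .fold (τ := τ) φ => {x : DomainLogic.sem τ.mu | unfold τ x ∈ φ.sem}
  | _, .inl (σ := σ) (τ := τ) φ =>
      (sumInl : DomainLogic.sem σ → sumObj (DomainLogic.sem σ) (DomainLogic.sem τ)) '' φ.sem
  | _, .inr (σ := σ) (τ := τ) φ =>
      (sumInr : DomainLogic.sem τ → sumObj (DomainLogic.sem σ) (DomainLogic.sem τ)) '' φ.sem
  | _, .imp (σ := σ) (τ := τ) ψ φ =>
      {f : ScottMap (DomainLogic.sem σ) (DomainLogic.sem τ) | ∀ x ∈ ψ.sem, f x ∈ φ.sem}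

end DomainLogic

/-!
Cutting off the syntax tree of a pure type `τ` at depth `n`, after unfolding its recursive types,
gives a finite bounded complete poset, the `n`-th approximant, that embeds into `⟦τ⟧`. These
embeddings increase with `n`, and the projections onto their images have supremum the identity. An
embedding preserves compact elements and every element of a finite poset is compact, so the compact
elements of `⟦τ⟧` are exactly those of its approximants.

Both directions of the correspondence now take place in the approximants. A satisfiable formula
denotes `↑ x` with `x` in every sufficiently deep approximant: conjunction is a supremum, which
exists by bounded completeness, and `ψ ⊩ φ` with `ψ` satisfiable is a step function. Conversely
`↑ f`, for an element `f` of an arrow approximant, is the conjunction of finitely many formulae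
`ψ ⊩ φ`, one for each element `a` of the domain, with `ψ` denoting `↑ a` and `φ` denoting `↑ (f a)`.

That the approximants exhaust `⟦rec X. τ⟧` is the point that needs care. This cpo is the colimit of
the iterates of `⟦τ⟧`, whereas the approximants see only the closed type `τ[rec X. τ / X]`. One
proves, for every open `τ`, every closing substitution `s` and every family of embeddings
`f i : X i → ⟦s i⟧`, that the image of `⟦τ⟧ f` in `⟦τ[s]⟧` is exhausted by the approximants of
`τ[s]` as soon as the image of each `f i` is exhausted by the approximants of `s i`.
-/

namespace DomainLogic

/-! ## Deflations -/

theorem isLUB_pair_iff {α : Type*} [Preorder α] {x y z : α} :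
    IsLUB {x, y} z ↔ ∀ u, z ≤ u ↔ x ≤ u ∧ y ≤ u := by
  simp only [isLUB_iff_le_iff, mem_upperBounds, Set.forall_mem_insert, Set.mem_singleton_iff,
    forall_eq]

theorem isCompactElement_of_finite {α : Type*} [PartialOrder α] [Finite α] (x : α) :
    IsCompactElement x := by
  intro D u hne hD hu hxu
  obtain ⟨m, hm, hmax⟩ := D.toFinite.exists_maximal hne
  exact ⟨m, hm, hxu.trans (hu.2 (hD.is_top_of_is_max hm fun _ hy => hmax hy))⟩

namespace EP

variable {X Y : Cpo}

theorem gc (f : X ⟶ Y) : GaloisConnection f.emb f.proj := fun x y =>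
  ⟨fun h => (f.proj_emb x).symm.trans_le (f.proj.mono h),
    fun h => (f.emb.mono h).trans (f.emb_proj y)⟩

theorem isLUB_pair_emb (f : X ⟶ Y) {a b c : X} (h : IsLUB {a, b} c) :
    IsLUB {f.emb a, f.emb b} (f.emb c) := by
  simpa only [Set.image_pair] using (gc f).isLUB_l_image h

theorem isCompactElement_emb (f : X ⟶ Y) {x : X} (hx : IsCompactElement x) :
    IsCompactElement (f.emb x) := by
  intro D s hne hD hs hxs
  obtain ⟨_, ⟨y, hy, rfl⟩, hxy⟩ := hx _ _ (hne.image f.proj)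
    (ScottMap.directed_image f.proj.mono hD) (f.proj.cont hne hD hs) ((gc f _ _).1 hxs)
  exact ⟨y, hy, (gc f _ _).2 hxy⟩

/-- The idempotent `emb ∘ proj ≤ id` on the target of an embedding-projection pair. -/
def deflation (f : X ⟶ Y) : ScottMap Y Y := f.emb.comp f.proj

theorem deflation_le (f : X ⟶ Y) (y : Y) : deflation f y ≤ y := f.emb_proj y

theorem isIso_of_le_deflation (f : X ⟶ Y) (h : ∀ y, y ≤ deflation f y) : IsIso f := by
  let g : Y ⟶ X := ⟨f.proj, f.emb, fun y => le_antisymm (deflation_le f y) (h y),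
    fun x => (f.proj_emb x).le⟩
  exact ⟨g, ep_ext fun x => f.proj_emb x, ep_ext fun y => le_antisymm (deflation_le f y) (h y)⟩

theorem proj_inv (f : X ⟶ Y) [IsIso f] (x : X) : EP.proj (inv f) x = f.emb x := by
  conv_lhs => rw [← f.proj_emb x, ← comp_proj, IsIso.inv_hom_id, id_proj]

end EP

theorem sumObj_cases {X Y : Cpo} {p : sumObj X Y → Prop} (bot : p ⊥) (inl : ∀ x, p (sumInl x))
    (inr : ∀ y, p (sumInr y)) (s : sumObj X Y) : p s :=
  WithBot.recBotCoe bot (Sum.rec inl inr) s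

theorem sumInl_le_sumInl {X Y : Cpo} {x x' : X} :
    (sumInl x : sumObj X Y) ≤ sumInl x' ↔ x ≤ x' :=
  WithBot.coe_le_coe.trans Sum.inl_le_inl_iff

theorem sumInr_le_sumInr {X Y : Cpo} {y y' : Y} :
    (sumInr y : sumObj X Y) ≤ sumInr y' ↔ y ≤ y' :=
  WithBot.coe_le_coe.trans Sum.inr_le_inr_iff

theorem sumInl_le_iff {X Y : Cpo} {x : X} {s : sumObj X Y} :
    sumInl x ≤ s ↔ ∃ x', x ≤ x' ∧ sumInl x' = s := by
  refine ⟨fun h => ?_, fun ⟨_, h, hs⟩ => hs ▸ sumInl_le_sumInl.2 h⟩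
  induction s using sumObj_cases with
  | bot => exact absurd h (WithBot.not_coe_le_bot _)
  | inl x' => exact ⟨x', sumInl_le_sumInl.1 h, rfl⟩
  | inr y => exact absurd (WithBot.coe_le_coe.1 h) Sum.not_inl_le_inr

theorem sumInr_le_iff {X Y : Cpo} {y : Y} {s : sumObj X Y} :
    sumInr y ≤ s ↔ ∃ y', y ≤ y' ∧ sumInr y' = s := by
  refine ⟨fun h => ?_, fun ⟨_, h, hs⟩ => hs ▸ sumInr_le_sumInr.2 h⟩
  induction s using sumObj_cases with
  | bot => exact absurd h (WithBot.not_coe_le_bot _)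
  | inl x => exact absurd (WithBot.coe_le_coe.1 h) Sum.not_inr_le_inl
  | inr y' => exact ⟨y', sumInr_le_sumInr.1 h, rfl⟩

theorem isLUB_bilimIn {F : ℕ ⥤ Cpo} (x : bilimObj F) :
    IsLUB (Set.range fun n => (bilimIn F n).emb (x.1 n)) x := by
  have hx : sSup (Set.range fun n => (bilimIn F n).emb (x.1 n)) = x :=
    congrArg (fun f : bilimObj F ⟶ bilimObj F => f.emb x) (bilimIsColimit F).desc_self
  have hlub := (cocone_emb_directed (bilimCocone F) x).isLUB_sSup
  exact Eq.subst (motive := IsLUB _) hx hlub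

theorem bilimIn_comp_map {F G : ℕ ⥤ Cpo} (α : F ⟶ G) (n : ℕ) :
    bilimIn F n ≫ bilim.map α = α.app n ≫ bilimIn G n :=
  (bilimIsColimit F).fac ⟨bilimObj G, α ≫ (bilimCocone G).ι⟩ n

namespace EP

variable {X Y Z X' Y' Z' : Cpo}

theorem deflation_comp_le (f : X ⟶ Y) (g : Y ⟶ Z) : deflation (f ≫ g) ≤ deflation g :=
  fun _ => g.emb.mono (deflation_le f _)

theorem deflation_comp_mono {f : X ⟶ Y} {f' : X' ⟶ Y} (h : deflation f ≤ deflation f')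
    (g : Y ⟶ Z) : deflation (f ≫ g) ≤ deflation (f' ≫ g) :=
  fun z => g.emb.mono (h (g.proj z))

theorem deflation_prodF_mono {f : X ⟶ Z} {f' : X' ⟶ Z} {g : Y ⟶ Z'} {g' : Y' ⟶ Z'}
    (hf : deflation f ≤ deflation f') (hg : deflation g ≤ deflation g') :
    deflation (prodF.map (Prod.mkHom f g)) ≤ deflation (prodF.map (Prod.mkHom f' g')) :=
  fun p => ⟨hf p.1, hg p.2⟩

theorem deflation_sumF_mono {f : X ⟶ Z} {f' : X' ⟶ Z} {g : Y ⟶ Z'} {g' : Y' ⟶ Z'}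
    (hf : deflation f ≤ deflation f') (hg : deflation g ≤ deflation g') :
    deflation (sumF.map (Prod.mkHom f g)) ≤ deflation (sumF.map (Prod.mkHom f' g')) :=
  sumObj_cases le_rfl (fun x => sumInl_le_sumInl.2 (hf x)) fun y => sumInr_le_sumInr.2 (hg y)

theorem deflation_arrowF_mono {f : X ⟶ Z} {f' : X' ⟶ Z} {g : Y ⟶ Z'} {g' : Y' ⟶ Z'}
    (hf : deflation f ≤ deflation f') (hg : deflation g ≤ deflation g') :
    deflation (arrowF.map (Prod.mkHom f g)) ≤ deflation (arrowF.map (Prod.mkHom f' g')) :=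
  fun h x => (hg _).trans ((deflation g').mono (ScottMap.mono h (hf x)))

theorem deflation_le_of_bilimIn {F : ℕ ⥤ Cpo} (f : bilimObj F ⟶ Y) {y u : Y}
    (h : ∀ n, deflation (bilimIn F n ≫ f) y ≤ u) : deflation f y ≤ u := by
  refine f.emb.map_le (Set.range_nonempty _) (cocone_emb_directed (bilimCocone F) _)
    (isLUB_bilimIn (f.proj y)) ?_
  rintro _ ⟨n, rfl⟩
  exact h n

end EP

open EP

/-! ## Covering families -/

/-- The subobjects `e k` of `Y` increase and together cover the subobject `f`: the deflation of `f`
is bounded by the supremum of the deflations of the `e k`. The supremum is expressed through its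
upper bounds, so that no directed set has to be named. -/
structure Covers {A : ℕ → Cpo} {X Y : Cpo} (e : ∀ k, A k ⟶ Y) (f : X ⟶ Y) : Prop where
  mono : Monotone fun k => deflation (e k)
  le_of_forall_le : ∀ y u, (∀ k, deflation (e k) y ≤ u) → deflation f y ≤ u

namespace Covers

variable {A B : ℕ → Cpo} {X X' Y Y' Z : Cpo}

theorem map_le {e : ∀ k, A k ⟶ Y} {f : X ⟶ Y} (h : Covers e f) (g : ScottMap Y Z) {y : Y} {v : Z}
    (hv : ∀ k, g (deflation (e k) y) ≤ v) : g (deflation f y) ≤ v := by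
  have hdir := (show Monotone fun k => deflation (e k) y from
    fun _ _ hij => h.mono hij y).directed_le.directedOn_range
  refine (g.mono (h.le_of_forall_le y _ fun k => hdir.le_sSup ⟨k, rfl⟩)).trans
    (g.map_le (Set.range_nonempty _) hdir hdir.isLUB_sSup ?_)
  rintro _ ⟨k, rfl⟩
  exact hv k

protected theorem prod {e : ∀ k, A k ⟶ Y} {f : X ⟶ Y} {e' : ∀ k, B k ⟶ Y'} {f' : X' ⟶ Y'}
    (h : Covers e f) (h' : Covers e' f') :
    Covers (fun k => prodF.map (Prod.mkHom (e k) (e' k))) (prodF.map (Prod.mkHom f f')) where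
  mono _ _ hij := deflation_prodF_mono (h.mono hij) (h'.mono hij)
  le_of_forall_le y u hu := ⟨h.le_of_forall_le y.1 u.1 fun k => (hu k).1,
    h'.le_of_forall_le y.2 u.2 fun k => (hu k).2⟩

protected theorem sum {e : ∀ k, A k ⟶ Y} {f : X ⟶ Y} {e' : ∀ k, B k ⟶ Y'} {f' : X' ⟶ Y'}
    (h : Covers e f) (h' : Covers e' f') :
    Covers (fun k => sumF.map (Prod.mkHom (e k) (e' k))) (sumF.map (Prod.mkHom f f')) where
  mono _ _ hij := deflation_sumF_mono (h.mono hij) (h'.mono hij)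
  le_of_forall_le y u := by
    induction y using sumObj_cases with
    | bot => exact fun hu => hu 0
    | inl y =>
      intro hu
      obtain ⟨u, -, rfl⟩ := sumInl_le_iff.1 (hu 0)
      exact sumInl_le_sumInl.2 (h.le_of_forall_le y u fun k => sumInl_le_sumInl.1 (hu k))
    | inr y =>
      intro hu
      obtain ⟨u, -, rfl⟩ := sumInr_le_iff.1 (hu 0)
      exact sumInr_le_sumInr.2 (h'.le_of_forall_le y u fun k => sumInr_le_sumInr.1 (hu k))

protected theorem arrow {e : ∀ k, A k ⟶ Y} {f : X ⟶ Y} {e' : ∀ k, B k ⟶ Y'} {f' : X' ⟶ Y'}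
    (h : Covers e f) (h' : Covers e' f') :
    Covers (fun k => arrowF.map (Prod.mkHom (e k) (e' k))) (arrowF.map (Prod.mkHom f f')) where
  mono _ _ hij := deflation_arrowF_mono (h.mono hij) (h'.mono hij)
  le_of_forall_le (g u : ScottMap Y Y') hu x := by
    refine h'.le_of_forall_le _ _ fun k => ?_
    refine h.map_le ((deflation (e' k)).comp g) fun l => ?_
    calc deflation (e' k) (g (deflation (e l) x))
        ≤ deflation (e' (max k l)) (g (deflation (e (max k l)) x)) :=
          (h'.mono (le_max_left k l) _).trans
            ((deflation _).mono (g.mono (h.mono (le_max_right k l) x)))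
      _ ≤ u x := hu (max k l) x

protected theorem comp {e : ∀ k, A k ⟶ Y} {f : X ⟶ Y} (h : Covers e f) (g : Y ⟶ Z) :
    Covers (fun k => e k ≫ g) (f ≫ g) where
  mono _ _ hij := deflation_comp_mono (h.mono hij) g
  le_of_forall_le z _ hu := h.map_le g.emb (y := g.proj z) hu

theorem of_bilimIn {F : ℕ ⥤ Cpo} {e : ∀ k, A k ⟶ Y} {f : bilimObj F ⟶ Y}
    (h : ∀ n, Covers e (bilimIn F n ≫ f)) : Covers e f :=
  ⟨(h 0).mono, fun y u hu => deflation_le_of_bilimIn f fun n => (h n).le_of_forall_le y u hu⟩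

theorem of_succ {e : ∀ k, A k ⟶ Y} {f : X ⟶ Y} (hmono : Monotone fun k => deflation (e k))
    (h : Covers (fun k => e (k + 1)) f) : Covers e f :=
  ⟨hmono, fun y u hu => h.le_of_forall_le y u fun k => hu (k + 1)⟩

protected theorem bilim {F : ℕ → ℕ ⥤ Cpo} {G H : ℕ ⥤ Cpo} {α : ∀ k, F k ⟶ G} {β : H ⟶ G}
    (h : ∀ n, Covers (fun k => (α k).app n) (β.app n)) :
    Covers (fun k => bilim.map (α k)) (bilim.map β) := by
  have hle (k n : ℕ) : deflation ((α k).app n ≫ bilimIn G n) ≤ deflation (bilim.map (α k)) :=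
    bilimIn_comp_map (α k) n ▸ deflation_comp_le _ _
  have hmono : Monotone fun k => deflation (bilim.map (α k)) := fun i j hij y =>
    deflation_le_of_bilimIn _ fun n =>
      bilimIn_comp_map (α i) n ▸ (((h n).comp (bilimIn G n)).mono hij y).trans (hle j n y)
  refine of_bilimIn fun n => ⟨hmono, fun y u hu => ?_⟩
  rw [bilimIn_comp_map]
  exact ((h n).comp (bilimIn G n)).le_of_forall_le y u fun k => (hle k n y).trans (hu k)

end Covers

theorem Covers.id (X : Cpo) : Covers (fun _ => 𝟙 X) (𝟙 X) :=
  ⟨fun _ _ _ => le_rfl, fun _ _ hu => hu 0⟩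

theorem covers_bilimIn (F : ℕ ⥤ Cpo) : Covers (bilimIn F) (𝟙 (bilimObj F)) where
  mono := monotone_nat_of_le_succ fun n => by
    have hw : F.map (homOfLE n.le_succ) ≫ bilimIn F (n + 1) = bilimIn F n := (bilimCocone F).w _
    exact hw ▸ deflation_comp_le _ _
  le_of_forall_le y _ hu := (isLUB_bilimIn y).2 (by rintro _ ⟨n, rfl⟩; exact hu n)

theorem covers_interp {n : ℕ} (τ : Ty n) {X : ℕ → Fin n → Cpo} {Y Z : Fin n → Cpo}
    {e : ∀ k, X k ⟶ Y} {f : Z ⟶ Y} (h : ∀ i, Covers (fun k => e k i) (f i)) :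
    Covers (fun k => (interp τ).map (e k)) ((interp τ).map f) := by
  induction τ with
  | var i => exact h i
  | unit => exact Covers.id two
  | prod σ τ hσ hτ => exact (hσ h).prod (hτ h)
  | arrow σ τ hσ hτ => exact (hσ h).arrow (hτ h)
  | sum σ τ hσ hτ => exact (hσ h).sum (hτ h)
  | mu τ hτ =>
    refine Covers.bilim fun m => ?_
    change Covers (fun k => iterMap _ (e k) m) (iterMap _ f m)
    induction m with
    | zero => exact Covers.id one
    | succ m ih => exact hτ (Fin.cases ih h)

theorem bilimIn_succ_comp_unfoldEP {B : Type*} [Category B] (G : B × Cpo ⥤ Cpo) (b : B) (n : ℕ) :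
    bilimIn ((iterChain G).obj b) (n + 1) ≫ unfoldEP G b =
      G.map (Prod.mkHom (𝟙 b) (bilimIn ((iterChain G).obj b) n)) :=
  (bilimIsColimit ((iterChain G).obj b)).fac (unfoldCocone G b) (n + 1)

theorem isIso_unfoldEP {n : ℕ} (τ : Ty (n + 1)) (X : Fin n → Cpo) :
    IsIso (unfoldEP (consF n ⋙ interp τ) X) := by
  set G := consF n ⋙ interp τ
  have hcov : Covers (fun k => G.map (Prod.mkHom (𝟙 X) (bilimIn ((iterChain G).obj X) k)))
      (G.map (𝟙 (X, (fixF G).obj X))) :=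
    covers_interp τ (Fin.cases (covers_bilimIn ((iterChain G).obj X)) fun i => Covers.id (X i))
  refine isIso_of_le_deflation _ fun y => ?_
  suffices deflation (G.map (𝟙 (X, (fixF G).obj X))) y ≤ _ by
    rwa [G.map_id] at this
  refine hcov.le_of_forall_le y _ fun k => ?_
  rw [← bilimIn_succ_comp_unfoldEP]
  exact deflation_comp_le _ _ y

/-- The isomorphism `unfold` as a morphism of embedding-projection pairs, which gives access to its
inverse `fold`. -/
noncomputable def unfoldHom (τ : Ty 1) : sem τ.mu ⟶ sem τ.unfolding :=
  unfoldEP (consF 0 ⋙ interp τ) (fun i => i.elim0) ≫ eqToHom (interp_unfolding τ _)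

instance isIso_unfoldHom (τ : Ty 1) : IsIso (unfoldHom τ) :=
  IsIso.comp_isIso' (isIso_unfoldEP τ _) (eqToIso (interp_unfolding τ _)).isIso_hom

/-! ## Finite approximants -/

/-- Bounded completeness, for pairs: two elements with an upper bound have a least upper bound. -/
def BoundedComplete (X : Type*) [Preorder X] : Prop :=
  ∀ ⦃x y u : X⦄, x ≤ u → y ≤ u → ∃ z, IsLUB {x, y} z

theorem BoundedComplete.of_semilatticeSup {X : Type*} [SemilatticeSup X] : BoundedComplete X :=
  fun _ _ _ _ _ => ⟨_, isLUB_pair⟩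

theorem BoundedComplete.prod {X Y : Cpo} (hX : BoundedComplete X) (hY : BoundedComplete Y) :
    BoundedComplete (prodObj X Y) := by
  intro p q u hp hq
  obtain ⟨x, hx⟩ := hX hp.1 hq.1
  obtain ⟨y, hy⟩ := hY hp.2 hq.2
  refine ⟨(x, y), isLUB_pair_iff.2 fun v => ?_⟩
  exact (and_congr (isLUB_pair_iff.1 hx v.1) (isLUB_pair_iff.1 hy v.2)).trans and_and_and_comm

theorem isLUB_pair_sumInl {X Y : Cpo} {x x' z : X} (h : IsLUB {x, x'} z) :
    IsLUB {(sumInl x : sumObj X Y), sumInl x'} (sumInl z) := by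
  rw [isLUB_pair_iff] at h ⊢
  refine fun s => ⟨fun hs => ?_, fun ⟨hs, hs'⟩ => ?_⟩
  · obtain ⟨u, hu, rfl⟩ := sumInl_le_iff.1 hs
    exact ⟨sumInl_le_sumInl.2 ((h u).1 hu).1, sumInl_le_sumInl.2 ((h u).1 hu).2⟩
  · obtain ⟨u, hu, rfl⟩ := sumInl_le_iff.1 hs
    exact sumInl_le_sumInl.2 ((h u).2 ⟨hu, sumInl_le_sumInl.1 hs'⟩)

theorem isLUB_pair_sumInr {X Y : Cpo} {y y' z : Y} (h : IsLUB {y, y'} z) :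
    IsLUB {(sumInr y : sumObj X Y), sumInr y'} (sumInr z) := by
  rw [isLUB_pair_iff] at h ⊢
  refine fun s => ⟨fun hs => ?_, fun ⟨hs, hs'⟩ => ?_⟩
  · obtain ⟨u, hu, rfl⟩ := sumInr_le_iff.1 hs
    exact ⟨sumInr_le_sumInr.2 ((h u).1 hu).1, sumInr_le_sumInr.2 ((h u).1 hu).2⟩
  · obtain ⟨u, hu, rfl⟩ := sumInr_le_iff.1 hs
    exact sumInr_le_sumInr.2 ((h u).2 ⟨hu, sumInr_le_sumInr.1 hs'⟩)

theorem BoundedComplete.sum {X Y : Cpo} (hX : BoundedComplete X) (hY : BoundedComplete Y) :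
    BoundedComplete (sumObj X Y) := by
  have hbot (s : sumObj X Y) : IsLUB {⊥, s} s :=
    isLUB_pair_iff.2 fun v => (and_iff_right bot_le).symm
  intro s t u hs ht
  induction s using sumObj_cases with
  | bot => exact ⟨t, hbot t⟩
  | inl x =>
    obtain ⟨u, hxu, rfl⟩ := sumInl_le_iff.1 hs
    induction t using sumObj_cases with
    | bot => exact ⟨sumInl x, Set.pair_comm _ _ ▸ hbot _⟩
    | inl x' => exact (hX hxu (sumInl_le_sumInl.1 ht)).imp' sumInl fun _ => isLUB_pair_sumInl
    | inr y => exact absurd (WithBot.coe_le_coe.1 ht) Sum.not_inr_le_inl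
  | inr y =>
    obtain ⟨u, hyu, rfl⟩ := sumInr_le_iff.1 hs
    induction t using sumObj_cases with
    | bot => exact ⟨sumInr y, Set.pair_comm _ _ ▸ hbot _⟩
    | inl x => exact absurd (WithBot.coe_le_coe.1 ht) Sum.not_inl_le_inr
    | inr y' => exact (hY hyu (sumInr_le_sumInr.1 ht)).imp' sumInr fun _ => isLUB_pair_sumInr

theorem BoundedComplete.arrow {X Y : Cpo} (hY : BoundedComplete Y) :
    BoundedComplete (arrowObj X Y) := by
  intro (f : ScottMap X Y) (g : ScottMap X Y) (u : ScottMap X Y) hf hg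
  choose k hk using fun x => hY (hf x) (hg x)
  simp only [isLUB_pair_iff] at hk
  have hkf (x) : f x ≤ k x := ((hk x _).1 le_rfl).1
  have hkg (x) : g x ≤ k x := ((hk x _).1 le_rfl).2
  have hcont : ScottContinuous k := ScottMap.scott_of
    (fun x y hxy => (hk x _).2 ⟨(f.mono hxy).trans (hkf y), (g.mono hxy).trans (hkg y)⟩)
    fun D s hne hD hs v hv => (hk s v).2
      ⟨f.map_le hne hD hs fun x hx => (hkf x).trans (hv x hx),
        g.map_le hne hD hs fun x hx => (hkg x).trans (hv x hx)⟩
  refine ⟨(⟨k, hcont⟩ : ScottMap X Y), isLUB_pair_iff.2 fun v => ?_⟩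
  exact (forall_congr' fun x => hk x _).trans forall_and

/-- The `n`-th finite approximant of a pure type: the interpretation of its syntax tree cut off at
depth `n`, each `mu` being replaced by its unfolding and the missing subtrees by the one-point
cpo. -/
noncomputable def approxObj : ℕ → Ty 0 → Cpo
  | 0, _ => one
  | _ + 1, .var i => i.elim0
  | _ + 1, .unit => two
  | n + 1, .prod σ τ => prodObj (approxObj n σ) (approxObj n τ)
  | n + 1, .arrow σ τ => arrowObj (approxObj n σ) (approxObj n τ)
  | n + 1, .sum σ τ => sumObj (approxObj n σ) (approxObj n τ)
  | n + 1, .mu τ => approxObj n τ.unfolding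

/-- The embedding of the `n`-th approximant of a pure type into its interpretation. -/
noncomputable def approx : ∀ (n : ℕ) (τ : Ty 0), approxObj n τ ⟶ sem τ
  | 0, τ => fromOne (sem τ)
  | _ + 1, .var i => i.elim0
  | _ + 1, .unit => 𝟙 two
  | n + 1, .prod σ τ => prodF.map (Prod.mkHom (approx n σ) (approx n τ))
  | n + 1, .arrow σ τ => arrowF.map (Prod.mkHom (approx n σ) (approx n τ))
  | n + 1, .sum σ τ => sumF.map (Prod.mkHom (approx n σ) (approx n τ))
  | n + 1, .mu τ => approx n τ.unfolding ≫ inv (unfoldHom τ)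

instance finite_approxObj (n : ℕ) (τ : Ty 0) : Finite (approxObj n τ) := by
  induction n generalizing τ with
  | zero => exact inferInstanceAs (Finite Unit)
  | succ n ih =>
    cases τ with
    | var i => exact i.elim0
    | unit => exact inferInstanceAs (Finite Prop)
    | prod σ τ => exact inferInstanceAs (Finite (approxObj n σ × approxObj n τ))
    | arrow σ τ => exact DFunLike.finite (ScottMap (approxObj n σ) (approxObj n τ))
    | sum σ τ => exact inferInstanceAs (Finite (Option (approxObj n σ ⊕ approxObj n τ)))
    | mu τ => exact ih τ.unfolding

theorem boundedComplete_approxObj (n : ℕ) (τ : Ty 0) : BoundedComplete (approxObj n τ) := by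
  induction n generalizing τ with
  | zero => exact .of_semilatticeSup (X := Unit)
  | succ n ih =>
    cases τ with
    | var i => exact i.elim0
    | unit => exact .of_semilatticeSup (X := Prop)
    | prod σ τ => exact (ih σ).prod (ih τ)
    | arrow σ τ => exact (ih τ).arrow
    | sum σ τ => exact (ih σ).sum (ih τ)
    | mu τ => exact ih τ.unfolding

theorem deflation_approx_mono (τ : Ty 0) : Monotone fun n => deflation (approx n τ) := by
  refine monotone_nat_of_le_succ fun n => ?_
  induction n generalizing τ with
  | zero => exact fun y => (bot_le : ⊥ ≤ deflation (approx 1 τ) y)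
  | succ n ih =>
    cases τ with
    | var i => exact i.elim0
    | unit => exact le_rfl
    | prod σ τ => exact deflation_prodF_mono (ih σ) (ih τ)
    | arrow σ τ => exact deflation_arrowF_mono (ih σ) (ih τ)
    | sum σ τ => exact deflation_sumF_mono (ih σ) (ih τ)
    | mu τ => exact deflation_comp_mono (ih τ.unfolding) _

/-! ## Substitution -/

namespace Ty

theorem liftRen_comp {n m k : ℕ} (ρ : Fin n → Fin m) (ρ' : Fin m → Fin k) :
    liftRen ρ' ∘ liftRen ρ = liftRen (ρ' ∘ ρ) :=
  funext <| Fin.cases rfl fun _ => rfl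

theorem rename_rename {n m k : ℕ} (τ : Ty n) (ρ : Fin n → Fin m) (ρ' : Fin m → Fin k) :
    (τ.rename ρ).rename ρ' = τ.rename (ρ' ∘ ρ) := by
  induction τ generalizing m k with
  | mu τ ih => simp only [rename, ih, liftRen_comp]
  | _ => simp_all only [rename, Function.comp_apply]

theorem liftSub_comp_liftRen {n m k : ℕ} (ρ : Fin n → Fin m) (t : Fin m → Ty k) :
    liftSub t ∘ liftRen ρ = liftSub (t ∘ ρ) :=
  funext <| Fin.cases rfl fun _ => rfl

theorem subst_rename {n m k : ℕ} (τ : Ty n) (ρ : Fin n → Fin m) (t : Fin m → Ty k) :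
    (τ.rename ρ).subst t = τ.subst (t ∘ ρ) := by
  induction τ generalizing m k with
  | mu τ ih => simp only [rename, subst, ih, liftSub_comp_liftRen]
  | _ => simp_all only [rename, subst, Function.comp_apply]

theorem rename_liftSub {n m k : ℕ} (s : Fin n → Ty m) (ρ : Fin m → Fin k) :
    rename (liftRen ρ) ∘ liftSub s = liftSub (rename ρ ∘ s) :=
  funext <| Fin.cases rfl fun i =>
    (rename_rename (s i) _ _).trans (rename_rename (s i) ρ Fin.succ).symm

theorem rename_subst {n m k : ℕ} (τ : Ty n) (s : Fin n → Ty m) (ρ : Fin m → Fin k) :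
    (τ.subst s).rename ρ = τ.subst (rename ρ ∘ s) := by
  induction τ generalizing m k with
  | mu τ ih => simp only [rename, subst, ih, rename_liftSub]
  | _ => simp_all only [rename, subst, Function.comp_apply]

theorem subst_liftSub {n m k : ℕ} (s : Fin n → Ty m) (t : Fin m → Ty k) :
    subst (liftSub t) ∘ liftSub s = liftSub (subst t ∘ s) :=
  funext <| Fin.cases rfl fun i =>
    (subst_rename (s i) _ _).trans (rename_subst (s i) t Fin.succ).symm

theorem subst_subst {n m k : ℕ} (τ : Ty n) (s : Fin n → Ty m) (t : Fin m → Ty k) :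
    (τ.subst s).subst t = τ.subst (subst t ∘ s) := by
  induction τ generalizing m k with
  | mu τ ih => simp only [subst, ih, subst_liftSub]
  | _ => simp_all only [subst, Function.comp_apply]

theorem liftSub_var (n : ℕ) : liftSub (var : Fin n → Ty n) = var :=
  funext <| Fin.cases rfl fun _ => rfl

theorem subst_var {n : ℕ} (τ : Ty n) : τ.subst var = τ := by
  induction τ with
  | mu τ ih => simp only [subst, liftSub_var, ih]
  | _ => simp_all only [subst]

theorem unfolding_subst {n m : ℕ} (τ : Ty (n + 1)) (s : Fin n → Ty m) :
    unfolding (τ.subst (liftSub s)) = τ.subst (Fin.cases (subst s (mu τ)) s) := by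
  refine (subst_subst τ _ _).trans (congrArg (subst · τ) (funext ?_))
  exact Fin.cases rfl fun i => (subst_rename (s i) _ _).trans (subst_var (s i))

end Ty

/-! ## Exhaustion by the approximants -/

/-- The approximants of the pure type `σ` jointly cover the morphism `f` into its interpretation,
where the latter is only known to be `Y` up to a propositional equality. -/
def ApproxCovers (σ : Ty 0) {X Y : Cpo} (h : sem σ = Y) (f : X ⟶ Y) : Prop :=
  Covers (fun k => approx k σ ≫ eqToHom h) f

namespace ApproxCovers

variable {σ τ : Ty 0} {X X' Y Z W : Cpo} {hY : sem σ = Y} {hZ : sem τ = Z}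

theorem iff_covers {f : X ⟶ sem σ} : ApproxCovers σ rfl f ↔ Covers (fun k => approx k σ) f := by
  simp only [ApproxCovers, eqToHom_refl, Category.comp_id]

theorem congr_type {σ' : Ty 0} (hσ : σ = σ') {f : X ⟶ Y} (h : ApproxCovers σ hY f) :
    ApproxCovers σ' (hσ ▸ hY) f := by
  subst hσ
  exact h

theorem of_succ {f : X ⟶ sem σ} (h : Covers (fun k => approx (k + 1) σ) f) :
    ApproxCovers σ rfl f :=
  iff_covers.2 (.of_succ (deflation_approx_mono σ) h)

theorem fromOne (f : one ⟶ Y) : ApproxCovers σ hY f := by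
  subst hY
  exact iff_covers.2 ⟨deflation_approx_mono σ, fun y u _ =>
    fromOne_unique (DomainLogic.fromOne _) f ▸ bot_le⟩

theorem unit (h : sem .unit = two) : ApproxCovers .unit h (𝟙 two) :=
  of_succ (Covers.id two)

theorem prod {f : X ⟶ Y} {g : X' ⟶ Z} (hf : ApproxCovers σ hY f) (hg : ApproxCovers τ hZ g)
    (h : sem (.prod σ τ) = prodObj Y Z) :
    ApproxCovers (.prod σ τ) h (prodF.map (Prod.mkHom f g)) := by
  subst hY hZ
  exact of_succ ((iff_covers.1 hf).prod (iff_covers.1 hg))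

theorem sum {f : X ⟶ Y} {g : X' ⟶ Z} (hf : ApproxCovers σ hY f) (hg : ApproxCovers τ hZ g)
    (h : sem (.sum σ τ) = sumObj Y Z) :
    ApproxCovers (.sum σ τ) h (sumF.map (Prod.mkHom f g)) := by
  subst hY hZ
  exact of_succ ((iff_covers.1 hf).sum (iff_covers.1 hg))

theorem arrow {f : X ⟶ Y} {g : X' ⟶ Z} (hf : ApproxCovers σ hY f) (hg : ApproxCovers τ hZ g)
    (h : sem (.arrow σ τ) = arrowObj Y Z) :
    ApproxCovers (.arrow σ τ) h (arrowF.map (Prod.mkHom f g)) := by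
  subst hY hZ
  exact of_succ ((iff_covers.1 hf).arrow (iff_covers.1 hg))

theorem comp_eqToHom {f : X ⟶ Y} (hf : ApproxCovers σ hY f) (e : Y = W) :
    ApproxCovers σ (hY.trans e) (f ≫ eqToHom e) := by
  subst e
  rwa [eqToHom_refl, Category.comp_id]

theorem fold {τ : Ty 1} {f : X ⟶ sem τ.mu}
    {h' : sem τ.unfolding = (consF 0 ⋙ interp τ).obj (fun i => i.elim0, sem τ.mu)}
    (h : ApproxCovers τ.unfolding h' (f ≫ unfoldEP (consF 0 ⋙ interp τ) fun i => i.elim0)) :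
    ApproxCovers τ.mu rfl f := by
  have hf : ApproxCovers τ.unfolding rfl (f ≫ unfoldHom τ) :=
    Category.assoc f _ _ ▸ h.comp_eqToHom (interp_unfolding τ _)
  have hinv := (iff_covers.1 hf).comp (inv (unfoldHom τ))
  rw [Category.assoc, IsIso.hom_inv_id, Category.comp_id] at hinv
  exact of_succ hinv

/- `interp_subst` identifies the chain of iterates of a substituted type with the chain `K`, `t` of
the original type only up to propositional equality; hence `hK` and `ht`. -/
theorem fold_bilimIn {τ : Ty 1} {K : (Fin 0 → Cpo) × Cpo ⥤ Cpo} (hK : consF 0 ⋙ interp τ = K)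
    {b : Fin 0 → Cpo} {t : ∀ m, iterObj K b m ⟶ iterObj K b (m + 1)} (ht : iterStep K b = t)
    (h : sem τ.mu = bilimObj (Functor.ofSequence t))
    (h' : sem τ.unfolding = K.obj (b, bilimObj (Functor.ofSequence t))) {m : ℕ}
    {f : X ⟶ iterObj K b (m + 1)}
    (hf : ApproxCovers τ.unfolding h'
      (f ≫ K.map (Prod.mkHom (𝟙 b) (bilimIn (Functor.ofSequence t) m)))) :
    ApproxCovers τ.mu h (f ≫ bilimIn (Functor.ofSequence t) (m + 1)) := by
  subst hK ht
  obtain rfl : (fun i => i.elim0) = b := funext fun i => i.elim0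
  refine fold (τ := τ) (h' := h') ((congrArg (ApproxCovers _ h') ?_).mpr hf)
  exact (Category.assoc f _ _).trans
    (congrArg (f ≫ ·) (bilimIn_succ_comp_unfoldEP (consF 0 ⋙ interp τ) _ m))

end ApproxCovers

theorem sem_subst {n : ℕ} (τ : Ty n) {s : Fin n → Ty 0} {Y : Fin n → Cpo}
    (hY : ∀ i, sem (s i) = Y i) : sem (τ.subst s) = (interp τ).obj Y := by
  obtain rfl : (fun i => sem (s i)) = Y := funext hY
  unfold sem
  rw [interp_subst]
  rfl

theorem map_prod_id_precomp.{v, u} {B B' : Type u} [Category.{v} B] [Category.{v} B']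
    (G : B × Cpo ⥤ Cpo) (H : B' ⥤ B) (b : B') {X Y : Cpo} (f : X ⟶ Y) :
    (H.prod (𝟭 Cpo) ⋙ G).map (Prod.mkHom (𝟙 b) f) = G.map (Prod.mkHom (𝟙 (H.obj b)) f) := by
  rw [← H.map_id]
  rfl

theorem ApproxCovers.subst_mu {n : ℕ} (τ : Ty (n + 1)) {s : Fin n → Ty 0} {X : Cpo}
    (h : sem ((Ty.mu τ).subst s) = (interp τ.mu).obj fun i => sem (s i))
    (h' : sem (τ.subst (Ty.liftSub s)).unfolding =
      (consF n ⋙ interp τ).obj (fun i => sem (s i), (interp τ.mu).obj fun i => sem (s i))) {m : ℕ}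
    {f : X ⟶ iterObj (consF n ⋙ interp τ) (fun i => sem (s i)) (m + 1)}
    (hf : ApproxCovers (τ.subst (Ty.liftSub s)).unfolding h' (f ≫ (consF n ⋙ interp τ).map
      (Prod.mkHom (𝟙 fun i => sem (s i))
        (bilimIn ((iterChain (consF n ⋙ interp τ)).obj fun i => sem (s i)) m)))) :
    ApproxCovers ((Ty.mu τ).subst s) h
      (f ≫ bilimIn ((iterChain (consF n ⋙ interp τ)).obj fun i => sem (s i)) (m + 1)) :=
  fold_bilimIn (K := (subF s).prod (𝟭 Cpo) ⋙ consF n ⋙ interp τ)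
    (by rw [interp_subst, ← Functor.assoc, cons_subF, Functor.assoc]) (iterStep_precomp _ _ _) h h'
    ((congrArg (fun g => ApproxCovers _ h' (f ≫ g))
      (map_prod_id_precomp (consF n ⋙ interp τ) (subF s) (fun i => i.elim0) _)).mpr hf)

theorem approxCovers_subst {n : ℕ} (τ : Ty n) {s : Fin n → Ty 0} {X Y : Fin n → Cpo}
    (hY : ∀ i, sem (s i) = Y i) {f : X ⟶ Y} (hf : ∀ i, ApproxCovers (s i) (hY i) (f i)) :
    ApproxCovers (τ.subst s) (sem_subst τ hY) ((interp τ).map f) := by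
  induction τ with
  | var i => exact hf i
  | unit => exact .unit _
  | prod σ τ hσ hτ => exact (hσ hY hf).prod (hτ hY hf) _
  | sum σ τ hσ hτ => exact (hσ hY hf).sum (hτ hY hf) _
  | arrow σ τ hσ hτ => exact (hσ hY hf).arrow (hτ hY hf) _
  | @mu n τ ih =>
    obtain rfl : (fun i => sem (s i)) = Y := funext hY
    let G := consF n ⋙ interp τ
    let inj := bilimIn ((iterChain G).obj fun i => sem (s i))
    refine Covers.of_bilimIn fun m => ?_
    suffices ApproxCovers ((Ty.mu τ).subst s) (sem_subst τ.mu hY) (iterMap G f m ≫ inj m) from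
      (congrArg (ApproxCovers _ (sem_subst τ.mu hY)) (bilimIn_comp_map ((iterChain G).map f) m)).mpr
        this
    -- `Ty.unfolding` enlarges the type, so the recursion is on the depth `m` of the iterate: the
    -- body `τ` is covered under the substitution that maps its new variable to `rec X. τ` itself,
    -- of which the first `m` iterates are already known to be covered.
    induction m with
    | zero => exact .fromOne _
    | succ m ihm =>
      have hY' : ∀ i, sem (Fin.cases (motive := fun _ => Ty 0) ((Ty.mu τ).subst s) s i) =
          (consF n).obj (fun i => sem (s i), (interp τ.mu).obj fun i => sem (s i)) i :=
        Fin.cases (sem_subst τ.mu hY) hY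
      have hsplit : Prod.mkHom f (iterMap G f m ≫ inj m) =
          Prod.mkHom f (iterMap G f m) ≫ Prod.mkHom (𝟙 fun i => sem (s i)) (inj m) :=
        Prod.ext (Category.comp_id f).symm rfl
      refine ApproxCovers.subst_mu τ _ (Ty.unfolding_subst τ s ▸ sem_subst τ hY') ?_
      refine (congrArg (ApproxCovers _ _) ((congrArg G.map hsplit).trans (G.map_comp _ _))).mp ?_
      exact (ih hY' (f := (consF n).map (Prod.mkHom f (iterMap G f m ≫ inj m)))
        (Fin.cases ihm hf)).congr_type (Ty.unfolding_subst τ s).symm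

theorem covers_approx (τ : Ty 0) : Covers (fun n => approx n τ) (𝟙 (sem τ)) := by
  have h := (approxCovers_subst τ (s := Ty.var) (fun i => i.elim0)
    (f := 𝟙 fun i => i.elim0) fun i => i.elim0).congr_type τ.subst_var
  rw [(interp τ).map_id] at h
  exact ApproxCovers.iff_covers.1 h

theorem isCompactElement_iff_exists_approx {τ : Ty 0} {d : sem τ} :
    IsCompactElement d ↔ ∃ n x, (approx n τ).emb x = d := by
  refine ⟨fun hd => ?_, ?_⟩
  · have hmono : Monotone fun n => deflation (approx n τ) d :=
      fun _ _ hij => deflation_approx_mono τ hij d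
    have hlub : IsLUB (Set.range fun n => deflation (approx n τ) d) d :=
      ⟨Set.forall_mem_range.2 fun n => deflation_le _ d, fun u hu =>
        (covers_approx τ).le_of_forall_le d u (Set.forall_mem_range.1 hu)⟩
    obtain ⟨_, ⟨n, rfl⟩, hn⟩ :=
      hd _ _ (Set.range_nonempty _) hmono.directed_le.directedOn_range hlub le_rfl
    exact ⟨n, _, le_antisymm (deflation_le _ d) hn⟩
  · rintro ⟨n, x, rfl⟩
    exact isCompactElement_emb _ (isCompactElement_of_finite x)

/-! ## Formulae -/

section Step
variable {X Y : Cpo}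

open scoped Classical in
/-- The step function with value `b` on the elements above the compact element `a`, and `⊥`
elsewhere. -/
noncomputable def step {a : X} (ha : IsCompactElement a) (b : Y) : ScottMap X Y where
  toFun x := if a ≤ x then b else ⊥
  cont := ScottMap.scott_of
    (fun x y hxy => by
      by_cases hx : a ≤ x
      · rw [if_pos hx, if_pos (hx.trans hxy)]
      · rw [if_neg hx]
        exact bot_le)
    (fun D s hne hD hs u hu => by
      split_ifs with has
      · obtain ⟨x, hx, hax⟩ := ha D s hne hD hs has
        simpa only [if_pos hax] using hu x hx
      · exact bot_le)

theorem step_le_iff {a : X} (ha : IsCompactElement a) {b : Y} {f : ScottMap X Y} :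
    step ha b ≤ f ↔ b ≤ f a := by
  refine ⟨fun h => (if_pos le_rfl).symm.trans_le (h a), fun h x => ?_⟩
  by_cases hax : a ≤ x
  · exact (if_pos hax).trans_le (h.trans (f.mono hax))
  · exact (if_neg hax).trans_le bot_le

end Step

namespace Form

variable {n : ℕ} {σ τ : Ty 0}

theorem sem_top_eq_Ici : (top : Form τ).sem = Set.Ici ((approx n τ).emb ⊥) :=
  Set.ext fun _ => iff_of_true trivial ((gc _ _ _).2 bot_le)

theorem sem_and_eq_Ici {φ ψ : Form τ} {x y z : approxObj n τ} (hz : IsLUB {x, y} z)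
    (hφ : φ.sem = Set.Ici ((approx n τ).emb x)) (hψ : ψ.sem = Set.Ici ((approx n τ).emb y)) :
    (φ.and ψ).sem = Set.Ici ((approx n τ).emb z) := by
  ext u
  rw [Set.mem_Ici, isLUB_pair_iff.1 (isLUB_pair_emb _ hz) u, Form.sem, hφ, hψ]
  rfl

theorem sem_unit_eq_Ici : unit.sem = Set.Ici ((approx (n + 1) .unit).emb (True : Prop)) :=
  Set.ext fun _ => (top_le_iff (α := Prop)).symm

theorem sem_fst_eq_Ici {φ : Form σ} {x : approxObj n σ}
    (hφ : φ.sem = Set.Ici ((approx n σ).emb x)) :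
    (fst (τ := τ) φ).sem = Set.Ici ((approx (n + 1) (.prod σ τ)).emb (x, ⊥)) := by
  rw [Form.sem, hφ]
  exact Set.ext fun p => (and_iff_left ((gc (approx n τ) _ p.2).2 bot_le)).symm

theorem sem_snd_eq_Ici {φ : Form τ} {y : approxObj n τ}
    (hφ : φ.sem = Set.Ici ((approx n τ).emb y)) :
    (snd (σ := σ) φ).sem = Set.Ici ((approx (n + 1) (.prod σ τ)).emb (⊥, y)) := by
  rw [Form.sem, hφ]
  exact Set.ext fun p => (and_iff_right ((gc (approx n σ) _ p.1).2 bot_le)).symm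

theorem sem_inl_eq_Ici {φ : Form σ} {x : approxObj n σ}
    (hφ : φ.sem = Set.Ici ((approx n σ).emb x)) :
    (inl (τ := τ) φ).sem = Set.Ici ((approx (n + 1) (.sum σ τ)).emb (sumInl x)) := by
  rw [Form.sem, hφ]
  exact Set.ext fun s => (sumInl_le_iff (s := s)).symm

theorem sem_inr_eq_Ici {φ : Form τ} {y : approxObj n τ}
    (hφ : φ.sem = Set.Ici ((approx n τ).emb y)) :
    (inr (σ := σ) φ).sem = Set.Ici ((approx (n + 1) (.sum σ τ)).emb (sumInr y)) := by
  rw [Form.sem, hφ]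
  exact Set.ext fun s => (sumInr_le_iff (s := s)).symm

theorem sem_fold_eq_Ici {τ : Ty 1} {φ : Form τ.unfolding} {x : approxObj n τ.unfolding}
    (hφ : φ.sem = Set.Ici ((approx n τ.unfolding).emb x)) :
    φ.fold.sem = Set.Ici ((approx (n + 1) τ.mu).emb x) := by
  rw [Form.sem, hφ]
  ext y
  change (approx n τ.unfolding).emb x ≤ (unfoldHom τ).emb y ↔
    (inv (unfoldHom τ)).emb ((approx n τ.unfolding).emb x) ≤ y
  rw [gc (inv (unfoldHom τ)) _ y, proj_inv]

theorem sem_imp_eq_Ici {ψ : Form σ} {φ : Form τ} {a : approxObj n σ} {b : approxObj n τ}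
    (hψ : ψ.sem = Set.Ici ((approx n σ).emb a)) (hφ : φ.sem = Set.Ici ((approx n τ).emb b)) :
    (ψ.imp φ).sem =
      Set.Ici ((approx (n + 1) (.arrow σ τ)).emb (step (isCompactElement_of_finite a) b)) := by
  ext (f : ScottMap (DomainLogic.sem σ) (DomainLogic.sem τ))
  calc f ∈ (ψ.imp φ).sem
      ↔ ∀ x, (approx n σ).emb a ≤ x → (approx n τ).emb b ≤ f x := by rw [Form.sem, hψ, hφ]; rfl
    _ ↔ (approx n τ).emb b ≤ f ((approx n σ).emb a) :=
      ⟨fun h => h _ le_rfl, fun h x hx => h.trans (f.mono hx)⟩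
    _ ↔ b ≤ ScottMap.toFun ((approx (n + 1) (.arrow σ τ)).proj f) a := gc (approx n τ) b _
    _ ↔ step (isCompactElement_of_finite a) b ≤ (approx (n + 1) (.arrow σ τ)).proj f :=
      (step_le_iff _).symm
    _ ↔ f ∈ Set.Ici ((approx (n + 1) (.arrow σ τ)).emb _) :=
      (gc (approx (n + 1) (.arrow σ τ)) _ f).symm

theorem exists_sem_eq_iInter {ι : Type*} [Finite ι] (φ : ι → Form τ) :
    ∃ δ : Form τ, δ.sem = ⋂ i, (φ i).sem := by
  suffices ∀ s : Set ι, s.Finite → ∃ δ : Form τ, δ.sem = ⋂ i ∈ s, (φ i).sem by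
    simpa only [Set.biInter_univ] using this _ Set.finite_univ
  intro s hs
  induction s, hs using Set.Finite.induction_on with
  | empty => exact ⟨top, by rw [Set.biInter_empty, Form.sem]⟩
  | @insert i s _ _ ih =>
    obtain ⟨δ, hδ⟩ := ih
    exact ⟨(φ i).and δ, by rw [Set.biInter_insert, ← hδ, Form.sem]⟩

theorem exists_sem_eq_Ici (n : ℕ) (τ : Ty 0) (x : approxObj n τ) :
    ∃ δ : Form τ, δ.sem = Set.Ici ((approx n τ).emb x) := by
  induction n generalizing τ with
  | zero => exact ⟨top, sem_top_eq_Ici (n := 0)⟩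
  | succ n ih =>
    cases τ with
    | var i => exact i.elim0
    | unit =>
      by_cases hx : (show Prop from x)
      · exact ⟨unit, eq_true hx ▸ sem_unit_eq_Ici⟩
      · exact ⟨top, eq_false hx ▸ sem_top_eq_Ici⟩
    | prod σ τ =>
      obtain ⟨φ, hφ⟩ := ih σ x.1
      obtain ⟨ψ, hψ⟩ := ih τ x.2
      refine ⟨φ.fst.and ψ.snd, sem_and_eq_Ici ?_ (sem_fst_eq_Ici hφ) (sem_snd_eq_Ici hψ)⟩
      exact isLUB_pair_iff.2 fun p =>
        and_congr (and_iff_left bot_le).symm (and_iff_right bot_le).symm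
    | arrow σ τ =>
      choose ψ hψ using ih σ
      choose φ hφ using fun a : approxObj n σ => ih τ (ScottMap.toFun x a)
      obtain ⟨δ, hδ⟩ := exists_sem_eq_iInter fun a => (ψ a).imp (φ a)
      refine ⟨δ, hδ.trans (Set.ext fun f => ?_)⟩
      simp only [Set.mem_iInter, sem_imp_eq_Ici (hψ _) (hφ _), Set.mem_Ici]
      rw [gc (approx (n + 1) (.arrow σ τ)) x f]
      exact forall_congr' fun a => (gc _ _ _).trans (step_le_iff _)
    | sum σ τ =>
      induction x using sumObj_cases with
      | bot => exact ⟨top, sem_top_eq_Ici⟩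
      | inl x => exact (ih σ x).imp' inl fun _ => sem_inl_eq_Ici
      | inr y => exact (ih τ y).imp' inr fun _ => sem_inr_eq_Ici
    | mu τ => exact (ih τ.unfolding x).imp' fold fun _ => sem_fold_eq_Ici

theorem exists_sem_and_eq_Ici {φ ψ : Form τ} {x y : approxObj n τ} (h : (φ.and ψ).sem.Nonempty)
    (hφ : φ.sem = Set.Ici ((approx n τ).emb x)) (hψ : ψ.sem = Set.Ici ((approx n τ).emb y)) :
    ∃ z, (φ.and ψ).sem = Set.Ici ((approx n τ).emb z) := by
  obtain ⟨u, huφ, huψ⟩ := h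
  rw [hφ, Set.mem_Ici, gc] at huφ
  rw [hψ, Set.mem_Ici, gc] at huψ
  obtain ⟨z, hz⟩ := boundedComplete_approxObj n τ huφ huψ
  exact ⟨z, sem_and_eq_Ici hz hφ hψ⟩

open Filter in
theorem eventually_exists_sem_eq_Ici (δ : Form τ) (hδ : δ.sem.Nonempty) :
    ∀ᶠ n in atTop, ∃ x, δ.sem = Set.Ici ((approx n τ).emb x) := by
  have of_succ {ρ : Ty 0} {δ : Form ρ}
      (h : ∀ᶠ n in atTop, ∃ x, δ.sem = Set.Ici ((approx (n + 1) ρ).emb x)) :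
      ∀ᶠ n in atTop, ∃ x, δ.sem = Set.Ici ((approx n ρ).emb x) := by
    rwa [← map_add_atTop_eq_nat 1, eventually_map]
  induction δ with
  | top => exact .of_forall fun n => ⟨⊥, sem_top_eq_Ici⟩
  | bot => exact absurd rfl hδ.ne_empty
  | and φ ψ ihφ ihψ =>
    filter_upwards [ihφ hδ.left, ihψ hδ.right] with n ⟨x, hx⟩ ⟨y, hy⟩
    exact exists_sem_and_eq_Ici hδ hx hy
  | unit => exact of_succ (.of_forall fun n => ⟨_, sem_unit_eq_Ici⟩)
  | fst φ ih =>
    obtain ⟨p, hp⟩ := hδ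
    exact of_succ ((ih ⟨p.1, hp⟩).mono fun n h => h.imp' _ fun _ => sem_fst_eq_Ici)
  | snd φ ih =>
    obtain ⟨p, hp⟩ := hδ
    exact of_succ ((ih ⟨p.2, hp⟩).mono fun n h => h.imp' _ fun _ => sem_snd_eq_Ici)
  | fold φ ih =>
    obtain ⟨x, hx⟩ := hδ
    exact of_succ ((ih ⟨_, hx⟩).mono fun n h => h.imp' _ fun _ => sem_fold_eq_Ici)
  | inl φ ih =>
    exact of_succ ((ih hδ.of_image).mono fun n h => h.imp' _ fun _ => sem_inl_eq_Ici)
  | inr φ ih =>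
    exact of_succ ((ih hδ.of_image).mono fun n h => h.imp' _ fun _ => sem_inr_eq_Ici)
  | imp ψ φ ihψ ihφ =>
    obtain hψ | ⟨a, ha⟩ := ψ.sem.eq_empty_or_nonempty
    · refine .of_forall fun n => ⟨⊥, Eq.trans ?_ sem_top_eq_Ici⟩
      exact Set.eq_univ_of_forall fun f x hx => absurd hx (hψ ▸ Set.notMem_empty x)
    · obtain ⟨f, hf⟩ := hδ
      refine of_succ ?_
      filter_upwards [ihψ ⟨a, ha⟩, ihφ ⟨_, hf a ha⟩] with n ⟨x, hx⟩ ⟨y, hy⟩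
      exact ⟨_, sem_imp_eq_Ici hx hy⟩

end Form

end DomainLogic

theorem mainTheorem8 (τ : DomainLogic.Ty 0) :
    (∀ δ : DomainLogic.Form τ, δ.sem.Nonempty →
      ∃ d : DomainLogic.sem τ, IsCompactElement d ∧ δ.sem = Set.Ici d) ∧
    (∀ d : DomainLogic.sem τ, IsCompactElement d →
      ∃ δ : DomainLogic.Form τ, Set.Ici d = δ.sem) := by
  refine ⟨fun δ hδ => ?_, fun d hd => ?_⟩
  · obtain ⟨n, x, hx⟩ := (DomainLogic.Form.eventually_exists_sem_eq_Ici δ hδ).exists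
    exact ⟨_, DomainLogic.isCompactElement_iff_exists_approx.2 ⟨n, x, rfl⟩, hx⟩
  · obtain ⟨n, x, rfl⟩ := DomainLogic.isCompactElement_iff_exists_approx.1 hd
    obtain ⟨δ, hδ⟩ := DomainLogic.Form.exists_sem_eq_Ici n τ x
    exact ⟨δ, hδ.symm⟩
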